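/- **Uniform consistency of the maximum likelihood estimator (MLE) in general pairwise comparison models.** *Model.* Let $A\subset\mathbb R$ be a measurable set with $A=-A$, and let $\nu$ be a reference measure on $\mathbb R$ invariant under $x\mapsto -x$ (e.g. Lebesgue measure for continuous outcomes, counting measure for discrete ones); write $\int_A\cdot\,dx$ for integration over $A$ against $\nu$. Let $f(x;y)$, $x\in A$, $y\in\mathbb R$, be a *valid* comparison density: (1) $f\ge 0$, $f(\cdot;y)$ is measurable, and $\int_A f(x;y)\,dx=1$ for all $y$; (2) $f(x;y)=f(-x;-y)$; (3) for $x\in A$ with $x<0$, $f(x;y)$ is non-increasing in $y$ and $f(x;y)\to0$ as $y\to\infty$; (4) $\sup_{y\in\mathbb R}f(x;y)<\infty$ for each $x\in A$. Assume moreover that $f$ is *strictly log-concave* in $y$: for every $x\in A$, $f(x;\cdot)>0$, $\log f(x;\cdot)$ is twice differentiable, and $\partial_y^2\log f(x;y)<0$ for all $y\in\mathbb R$. Put $g(x;y)=\partial_y\log f(x;y)$ and $g_2(x;y)=\partial_y g(x;y)$. For each $n$ let $\mathbf u=\mathbf u_n\in\mathbb R^n$ be the true score vector, with $u_1=0$,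 and let $p_n\in(0,1]$; let $T\ge1$ be a fixed integer. The data for $n$ subjects consist of independent multiplicities $n_{ij}\sim \mathrm{Bin}(T,p_n)$, $1\le i<j\le n$, and, independently of these, independent outcomes $X_{ij}^{(t)}$, where $X^{(t)}_{ij}$ has density $f(\cdot\,;u_i-u_j)$; the outcomes with $t\le n_{ij}$ are observed. The data for all $n$ live on one probability space (with arbitrary dependence between different $n$). The log-likelihood is $$l(\mathbf v)=\sum_{1\le i<j\le n}\ \sum_{t=1}^{n_{ij}}\log f\big(X_{ij}^{(t)};v_i-v_j\big),$$ and an MLE $\hat{\mathbf u}$ is a maximizer of $l$ over $\{\mathbf v\in\mathbb R^n: v_1=0\}$. *Constants.* Let $M_n=\max_{i,j}|u_i-u_j|$ and $$C^{(1)}_n=\int_{A\cap[0,\infty)}f(x;M_n)\,dx,\qquad C^{(2)}_n=\sup_{x\in A,\,|y|\le M_n}|g(x;y)|,$$ $$C^{(3)}_n=\sup_{x\in A,\,|y|\le M_n+1}|g_2(x;y)|,\qquad C^{(4)}_n=\inf_{x\in A,\,|y|\le M_n+1}|g_2(x;y)|,$$ where $C_n^{(2)},C_n^{(3)}\in[0,\infty]$.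 *Theorem.* Assume that, as $n\to\infty$, $$\frac{\log n}{n p_n\,|\log C^{(1)}_n|}\to0\qquad\text{and}\qquad \Delta_n:=\frac{C^{(2)}_nC^{(3)}_n}{(C^{(4)}_n)^2}\sqrt{\frac{\log n}{np_n}}\;\frac{\log n}{\log (np_n)}\to0$$ (where $\Delta_n=\infty$ if $C^{(2)}_n=\infty$, $C^{(3)}_n=\infty$ or $C^{(4)}_n=0$). Then there is a constant $C$ independent of $n$ such that for all sufficiently large $n$, with probability at least $1-14n^{-2}$, the MLE $\hat{\mathbf u}$ exists, is unique, and satisfies $$\|\hat{\mathbf u}-\mathbf u\|_\infty\le C\,\Delta_n .$$ In particular $\hat{\mathbf u}$ is uniformly consistent: almost surely, $\hat{\mathbf u}$ exists and is unique for all but finitely many $n$, and $\|\hat{\mathbf u}-\mathbf u\|_\infty\to0$. -/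

import Mathlib

open MeasureTheory ProbabilityTheory Filter Topology
open scoped NNReal ENNReal

namespace PairwiseComparison

noncomputable section

/-- A *valid* comparison density `f(x; y)`: `x` ranges over the symmetric outcome set `A`, `y` is
the relative score, and `ν` is the reference measure for "density (mass) function"; e.g. Lebesgue
measure for continuous outcomes and counting measure for discrete ones. -/
structure IsValid (A : Set ℝ) (ν : Measure ℝ) (f : ℝ → ℝ → ℝ) : Prop where
  measurableSet : MeasurableSet A
  symm : ∀ x ∈ A, -x ∈ A
  aemeasurable : ∀ y, AEMeasurable (fun x => f x y) (ν.restrict A)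
  nonneg : ∀ x ∈ A, ∀ y, 0 ≤ f x y
  lintegral_eq_one : ∀ y, ∫⁻ x in A, ENNReal.ofReal (f x y) ∂ν = 1
  even : ∀ x ∈ A, ∀ y, f x y = f (-x) (-y)
  antitone : ∀ x ∈ A, x < 0 → Antitone (f x)
  tendsto_zero : ∀ x ∈ A, x < 0 → Tendsto (f x) atTop (𝓝 0)
  bddAbove : ∀ x ∈ A, BddAbove (Set.range (f x))

/-- `g(x; y) = ∂/∂y log f(x; y)`. -/
def score (f : ℝ → ℝ → ℝ) (x y : ℝ) : ℝ :=
  deriv (fun z => Real.log (f x z)) y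

/-- `g₂(x; y) = ∂/∂y g(x; y)`. -/
def scoreDeriv (f : ℝ → ℝ → ℝ) (x y : ℝ) : ℝ :=
  deriv (score f x) y

/-- For every outcome `x ∈ A`, the function `f(x; ·)` is positive, its logarithm is twice
differentiable, and the second derivative of the logarithm is negative everywhere. -/
structure IsStrictlyLogConcave (A : Set ℝ) (f : ℝ → ℝ → ℝ) : Prop where
  pos : ∀ x ∈ A, ∀ y, 0 < f x y
  differentiable_log : ∀ x ∈ A, Differentiable ℝ (fun y => Real.log (f x y))
  differentiable_score : ∀ x ∈ A, Differentiable ℝ (score f x)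
  scoreDeriv_neg : ∀ x ∈ A, ∀ y, scoreDeriv f x y < 0

/-- The law of one comparison with relative score `y`: density `f(·; y)` on `A` with respect to
`ν`. -/
def outcomeLaw (A : Set ℝ) (ν : Measure ℝ) (f : ℝ → ℝ → ℝ) (y : ℝ) : Measure ℝ :=
  (ν.restrict A).withDensity fun x => ENNReal.ofReal (f x y)

/-- The dynamic range `max_{i,j} |u_i - u_j|`. -/
def dynamicRange {n : ℕ} (u : Fin n → ℝ) : ℝ :=
  ⨆ e : Fin n × Fin n, |u e.1 - u e.2|

/-- The global discrepancy `C⁽¹⁾ = ∫_{[0,∞)} f(x; M) dx`. -/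
def C₁ (A : Set ℝ) (ν : Measure ℝ) (f : ℝ → ℝ → ℝ) (M : ℝ) : ℝ :=
  ∫ x in A ∩ Set.Ici 0, f x M ∂ν

/-- `C⁽²⁾ = sup_{x ∈ A, |y| ≤ M} |g(x; y)|`, possibly infinite. -/
def C₂ (A : Set ℝ) (f : ℝ → ℝ → ℝ) (M : ℝ) : ℝ≥0∞ :=
  ⨆ x ∈ A, ⨆ y ∈ Set.Icc (-M) M, ENNReal.ofReal |score f x y|

/-- `C⁽³⁾ = sup_{x ∈ A, |y| ≤ M + 1} |g₂(x; y)|`, possibly infinite. -/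
def C₃ (A : Set ℝ) (f : ℝ → ℝ → ℝ) (M : ℝ) : ℝ≥0∞ :=
  ⨆ x ∈ A, ⨆ y ∈ Set.Icc (-(M + 1)) (M + 1), ENNReal.ofReal |scoreDeriv f x y|

/-- `C⁽⁴⁾ = inf_{x ∈ A, |y| ≤ M + 1} |g₂(x; y)|`, possibly zero. -/
def C₄ (A : Set ℝ) (f : ℝ → ℝ → ℝ) (M : ℝ) : ℝ≥0∞ :=
  ⨅ x ∈ A, ⨅ y ∈ Set.Icc (-(M + 1)) (M + 1), ENNReal.ofReal |scoreDeriv f x y|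

/-- `Δ = C⁽²⁾ C⁽³⁾ / (C⁽⁴⁾)² · √(log n / (n p)) · (log n / log (n p))`. The value is `∞` when
`C⁽²⁾` or `C⁽³⁾` is infinite or `C⁽⁴⁾ = 0` (for `n ≥ 2` and `n p > 1`). -/
def Delta (A : Set ℝ) (f : ℝ → ℝ → ℝ) (M : ℝ) (n : ℕ) (p : ℝ) : ℝ≥0∞ :=
  C₂ A f M * C₃ A f M / C₄ A f M ^ 2 *
    ENNReal.ofReal (√(Real.log n / (n * p)) * (Real.log n / Real.log (n * p)))

/-- Unordered pairs of distinct subjects, listed as `(i, j)` with `i < j`. -/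
abbrev Pair (n : ℕ) : Type := {e : Fin n × Fin n // e.1 < e.2}

/-- The comparison data on `n` subjects with true scores `u`: the multiplicities `N e` are i.i.d.
`Bin(T, p)`; the outcomes `X e t`, `t < T`, are independent, independent of the multiplicities, and
`X (i, j) t` has density `f(·; u_i - u_j)`. Of these, the outcomes with `t < N e` are observed. -/
structure IsComparisonData (A : Set ℝ) (ν : Measure ℝ) (f : ℝ → ℝ → ℝ) (T : ℕ)
    (p : unitInterval) {n : ℕ} (u : Fin n → ℝ) {Ω : Type*} [MeasurableSpace Ω] (P : Measure Ω)
    (N : Pair n → Ω → ℕ) (X : Pair n → Fin T → Ω → ℝ) : Prop where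
  hasLaw_mult : ∀ e, HasLaw (N e) (binomial T p) P
  hasLaw_outcome : ∀ e t, HasLaw (X e t) (outcomeLaw A ν f (u e.1.1 - u e.1.2)) P
  indep_mult : iIndepFun N P
  indep_outcome : iIndepFun (fun (s : Pair n × Fin T) => X s.1 s.2) P
  indep_mult_outcome : IndepFun (fun ω e => N e ω)
    (fun ω (s : Pair n × Fin T) => X s.1 s.2 ω) P

/-- The conditional log-likelihood
`l(v) = ∑_{i < j} ∑_{t ≤ n_ij} log f(X_ij⁽ᵗ⁾; v_i - v_j)`. -/
def logLikelihood (f : ℝ → ℝ → ℝ) {n T : ℕ} (N : Pair n → ℕ) (X : Pair n → Fin T → ℝ)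
    (v : Fin n → ℝ) : ℝ :=
  ∑ e : Pair n, ∑ t : Fin T with t.val < N e, Real.log (f (X e t) (v e.1.1 - v e.1.2))

/-- The parameter space `{v ∈ ℝⁿ : v_1 = 0}` (the first subject has index `0`). -/
def normalized (n : ℕ) : Set (Fin n → ℝ) :=
  {v | ∀ i : Fin n, i.val = 0 → v i = 0}

/-- `v` is a maximum likelihood estimate: a maximizer of the log-likelihood under `v_1 = 0`. -/
def IsMLE (f : ℝ → ℝ → ℝ) {n T : ℕ} (N : Pair n → ℕ) (X : Pair n → Fin T → ℝ)
    (v : Fin n → ℝ) : Prop :=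
  v ∈ normalized n ∧ IsMaxOn (logLikelihood f N X) (normalized n) v

end

end PairwiseComparison

/-! ### Cuts, level sets and expansion. -/

namespace PairwiseComparison

/-! Maximize the likelihood first over vectors `v` whose differences stay within 1 of those of `u`,
a compact problem up to translation. With w = v - u, lowering an upper level set S of w is an
admissible direction, so the score at `v`, summed across the cut of S, has a sign. The score
decreases with slope at least c₄ on [-(M+1), M+1]; hence c₄ times the sum of |w_i - w_j| over
observed comparisons across the cut is at most the score noise at the truth (`cut_deviation_le`).
That noise is centred and, uniformly in S, at most of order c₂ √(np log n) |S|. So the gaps across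
the cut sum to at most δ |S| np / 16, with δ of order (c₂/c₄) √(log n / np).

The comparison graph expands: more than |S| np / 8 comparisons leave S if |S| ≤ n/2, but fewer than
|S| np / 16 join S to a set R with |R| ≤ n/(64T) and |R| ≤ ρ|S|, where ρ = np / (320 log n).
Lowering the level by δ therefore adds at least min(n/(64T), ρ|S|) members (`level_step`). Some K
steps of geometric growth and 64T steps of linear growth reach a majority of the subjects
(`card_upper_gt_half`). The same holds for -w, and two majorities meet, so w oscillates by at most
2(K + 64T)δ. Once this is below 1 the maximizer is interior, hence global by concavity; strict
concavity and connectedness of the graph give uniqueness.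

Randomness enters through exponential moment bounds that give each set a failure weight of n⁻³ per
member, which makes unions over all sets summable. Asymptotically, log n / (np) tends to 0 because
C⁽¹⁾ is bounded away from 0 (`tendsto_log_div`), K is of order log n / log(np) by smallness of Δ
(`exists_steps`), and Borel-Cantelli gives the almost sure statement. -/

/-- The pairs with one member in `S` and the other in `R`. -/
def crossing {n : ℕ} (S R : Finset (Fin n)) : Finset (Pair n) :=
  Finset.univ.filter fun e => (e.1.1 ∈ S ∧ e.1.2 ∈ R) ∨ (e.1.1 ∈ R ∧ e.1.2 ∈ S)

lemma mem_crossing {n : ℕ} {S R : Finset (Fin n)} {e : Pair n} :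
    e ∈ crossing S R ↔ (e.1.1 ∈ S ∧ e.1.2 ∈ R) ∨ (e.1.1 ∈ R ∧ e.1.2 ∈ S) := by
  simp [crossing]

lemma crossing_comm {n : ℕ} (S R : Finset (Fin n)) : crossing S R = crossing R S := by
  ext e; simp only [mem_crossing]; tauto

lemma card_crossing {n : ℕ} {S R : Finset (Fin n)} (h : Disjoint S R) :
    (crossing S R).card = S.card * R.card := by
  rw [← Finset.card_product]
  have hne : ∀ a ∈ S ×ˢ R, a.1 ≠ a.2 := by
    intro a ha hEq
    rw [Finset.mem_product] at ha
    exact Finset.disjoint_left.1 h ha.1 (hEq ▸ ha.2)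
  symm
  refine Finset.card_bij
    (fun a ha => if hlt : a.1 < a.2 then (⟨(a.1, a.2), hlt⟩ : Pair n)
      else ⟨(a.2, a.1), lt_of_le_of_ne (not_lt.1 hlt) (hne a ha).symm⟩) ?_ ?_ ?_
  · intro a ha
    have ha' := Finset.mem_product.1 ha
    rw [mem_crossing]
    split_ifs with hlt
    · exact Or.inl ha'
    · exact Or.inr ⟨ha'.2, ha'.1⟩
  · intro a ha b hb hab
    have ha' := Finset.mem_product.1 ha
    have hb' := Finset.mem_product.1 hb
    have hd := Finset.disjoint_left.1 h
    split_ifs at hab with h1 h2 h2 <;>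
      simp only [Subtype.mk.injEq, Prod.mk.injEq] at hab <;> obtain ⟨e1, e2⟩ := hab
    · exact Prod.ext e1 e2
    · exact absurd (e1 ▸ hb'.2) (hd ha'.1)
    · exact absurd (e1 ▸ ha'.2) (hd hb'.1)
    · exact Prod.ext e2 e1
  · rintro ⟨⟨i, j⟩, hij⟩ he
    simp only at hij
    rw [mem_crossing] at he
    rcases he with he | he
    · exact ⟨(i, j), Finset.mem_product.2 he, by simp [hij]⟩
    · exact ⟨(j, i), Finset.mem_product.2 ⟨he.2, he.1⟩, by simp [hij.not_gt]⟩

lemma sum_crossing_union {n : ℕ} {S R Q : Finset (Fin n)} (hSR : Disjoint S R)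
    (hSQ : Disjoint S Q) (hRQ : Disjoint R Q) (m : Pair n → ℝ) :
    ∑ e ∈ crossing S (R ∪ Q), m e = ∑ e ∈ crossing S R, m e + ∑ e ∈ crossing S Q, m e := by
  rw [← Finset.sum_union]
  · congr 1
    ext e
    simp only [Finset.mem_union, mem_crossing]
    tauto
  · rw [Finset.disjoint_left] at *
    intro e h1 h2
    rw [mem_crossing] at h1 h2
    rcases h1 with h1 | h1 <;> rcases h2 with h2 | h2
    · exact hRQ h1.2 h2.2
    · exact hSQ h1.1 h2.1
    · exact hSR h2.1 h1.1
    · exact hRQ h1.1 h2.1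

open Classical in
/-- The upper level set `{w ≥ c}`. -/
noncomputable def upper {n : ℕ} (w : Fin n → ℝ) (c : ℝ) : Finset (Fin n) :=
  Finset.univ.filter fun i => c ≤ w i

lemma mem_upper {n : ℕ} {w : Fin n → ℝ} {c : ℝ} {i : Fin n} : i ∈ upper w c ↔ c ≤ w i := by
  simp [upper]

lemma upper_anti {n : ℕ} (w : Fin n → ℝ) {c d : ℝ} (h : d ≤ c) : upper w c ⊆ upper w d :=
  fun _ hi => mem_upper.2 (h.trans (mem_upper.1 hi))

/-- Lowering the level by `δ` adds many new members to an upper level set. -/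
lemma level_step {n : ℕ} {m : Pair n → ℝ} (hm : ∀ e, 0 ≤ m e) {w : Fin n → ℝ}
    {δ x ρ b c : ℝ} (hδ : 0 < δ)
    (hcut : ∀ S : Finset (Fin n), S.Nonempty → 2 * S.card ≤ n →
      S.card * x / 8 < ∑ e ∈ crossing S Sᶜ, m e)
    (hsmall : ∀ S R : Finset (Fin n), S.Nonempty → Disjoint S R → (R.card : ℝ) ≤ b →
      (R.card : ℝ) ≤ ρ * S.card → ∑ e ∈ crossing S R, m e < S.card * x / 16)
    (hlevel : ∑ e ∈ crossing (upper w c) (upper w c)ᶜ, m e * |w e.1.1 - w e.1.2| ≤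
      δ * ((upper w c).card * x / 16))
    (hne : (upper w c).Nonempty) (hhalf : 2 * (upper w c).card ≤ n) :
    (upper w c).card + min b (ρ * (upper w c).card) ≤ ((upper w (c - δ)).card : ℝ) := by
  classical
  set S := upper w c with hS
  set S' := upper w (c - δ) with hS'
  have hsub : S ⊆ S' := upper_anti w (by linarith)
  set R := S' \ S with hR
  have hSR : Disjoint S R := Finset.disjoint_sdiff
  have hcard : (S'.card : ℝ) = S.card + R.card := by
    rw [hR, Finset.cast_card_sdiff hsub]; ring
  rw [hcard]
  by_contra! hlt
  have hlt' : (R.card : ℝ) < min b (ρ * S.card) := by linarith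
  have h2 := hsmall S R hne hSR (hlt'.le.trans (min_le_left _ _)) (hlt'.le.trans (min_le_right _ _))
  have h1 := hcut S hne hhalf
  have hcompl : Sᶜ = R ∪ S'ᶜ := by
    ext i
    have := @hsub i
    simp only [hR, Finset.mem_compl, Finset.mem_union, Finset.mem_sdiff]
    tauto
  have hSQ : Disjoint S S'ᶜ := Finset.disjoint_left.2 fun i hi hi' =>
    (Finset.mem_compl.1 hi') (hsub hi)
  have hRQ : Disjoint R S'ᶜ := Finset.disjoint_left.2 fun i hi hi' =>
    (Finset.mem_compl.1 hi') (Finset.mem_sdiff.1 hi).1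
  -- Edges from S to outside S' span a gap above δ, so their weight is at most |S|x/16. If R were
  -- too small, the edges into it would weigh less than |S|x/16, contradicting the cut bound |S|x/8.
  have hfar : δ * ∑ e ∈ crossing S S'ᶜ, m e ≤
      ∑ e ∈ crossing S S'ᶜ, m e * |w e.1.1 - w e.1.2| := by
    rw [Finset.mul_sum]
    refine Finset.sum_le_sum fun e he => ?_
    rw [mul_comm]
    refine mul_le_mul_of_nonneg_left ?_ (hm e)
    simp only [mem_crossing, Finset.mem_compl, hS, hS', mem_upper, not_le] at he
    rcases he with he | he
    · exact le_trans (by linarith) (le_abs_self _)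
    · exact le_trans (by linarith) (neg_le_abs _)
  rw [hcompl, sum_crossing_union hSR hSQ hRQ] at h1 hlevel
  have hpos : 0 ≤ ∑ e ∈ crossing S R, m e * |w e.1.1 - w e.1.2| :=
    Finset.sum_nonneg fun e _ => mul_nonneg (hm e) (abs_nonneg _)
  have h3 : ∑ e ∈ crossing S S'ᶜ, m e ≤ S.card * x / 16 :=
    le_of_mul_le_mul_left (by linarith) hδ
  linarith

/-- Iterating `level_step`, the upper level set reaches more than half of the subjects. -/
lemma card_upper_gt_half {n : ℕ} {m : Pair n → ℝ} (hm : ∀ e, 0 ≤ m e) {w : Fin n → ℝ}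
    {δ x ρ : ℝ} {J K : ℕ} (hδ : 0 < δ) (hρ : 1 ≤ ρ) (hJ : 1 ≤ J) (hK : (n : ℝ) ≤ ρ ^ K)
    (hcut : ∀ S : Finset (Fin n), S.Nonempty → 2 * S.card ≤ n →
      S.card * x / 8 < ∑ e ∈ crossing S Sᶜ, m e)
    (hsmall : ∀ S R : Finset (Fin n), S.Nonempty → Disjoint S R → (R.card : ℝ) ≤ n / J →
      (R.card : ℝ) ≤ ρ * S.card → ∑ e ∈ crossing S R, m e < S.card * x / 16)
    (hlevel : ∀ c, (upper w c).Nonempty →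
      ∑ e ∈ crossing (upper w c) (upper w c)ᶜ, m e * |w e.1.1 - w e.1.2| ≤
      δ * ((upper w c).card * x / 16)) (i : Fin n) :
    n < 2 * (upper w (w i - (K + J : ℕ) * δ)).card := by
  set a : ℕ → ℕ := fun k => (upper w (w i - k * δ)).card with ha
  have hn : 0 < n := i.pos
  have hJ0 : (0 : ℝ) < J := by exact_mod_cast hJ
  have hnJ : 0 < (n : ℝ) / J := by positivity
  have hnJ' : (n : ℝ) / J ≤ n := div_le_self (by positivity) (by exact_mod_cast hJ)
  have hmem : ∀ k : ℕ, i ∈ upper w (w i - k * δ) := fun k =>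
    mem_upper.2 (by have : 0 ≤ k * δ := by positivity
                    linarith)
  have hne : ∀ k : ℕ, (upper w (w i - k * δ)).Nonempty := fun k => ⟨i, hmem k⟩
  have hmono : ∀ k, a k ≤ a (k + 1) := fun k => Finset.card_le_card (upper_anti w (by
    push_cast; nlinarith))
  have hstep : ∀ k, 2 * a k ≤ n → a k + min ((n : ℝ) / J) (ρ * a k) ≤ a (k + 1) := by
    intro k hk
    have := level_step hm hδ hcut hsmall (hlevel _ (hne k)) (hne k) hk
    simp only [ha]
    convert this using 4
    push_cast; ring
  -- Geometric growth by the factor ρ until the size reaches n/J.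
  have hphase1 : ∀ k, n < 2 * a k ∨ min ((n : ℝ) / J) (ρ ^ k) ≤ a k := by
    intro k
    induction k with
    | zero =>
      right
      refine (min_le_right _ _).trans ?_
      have : 1 ≤ a 0 := Finset.card_pos.2 (hne 0)
      simpa using this
    | succ k ih =>
      by_cases hk : 2 * a k ≤ n
      · right
        have h1 := hstep k hk
        rcases ih with ih | ih
        · omega
        have hak : (0 : ℝ) ≤ a k := by positivity
        rcases le_total ((n : ℝ) / J) (ρ * a k) with hc | hc
        · rw [min_eq_left hc] at h1
          exact (min_le_left _ _).trans (by linarith)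
        · rw [min_eq_right hc] at h1
          rcases min_le_iff.1 ih with h2 | h2
          · refine (min_le_left _ _).trans ?_
            nlinarith
          · refine (min_le_right _ _).trans ?_
            rw [pow_succ']
            nlinarith
      · left
        have := hmono k
        omega
  -- Since n ≤ ρ ^ K, the size is at least n/J after K steps; each later step adds n/J, and J of
  -- them would exceed n.
  have hphase2 : ∀ j, n < 2 * a (K + j) ∨ (1 + j) * ((n : ℝ) / J) ≤ a (K + j) := by
    intro j
    induction j with
    | zero =>
      rcases hphase1 K with h | h
      · exact Or.inl h
      · right
        rw [min_eq_left (hnJ'.trans hK)] at h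
        simpa using h
    | succ j ih =>
      by_cases hk : 2 * a (K + j) ≤ n
      · right
        rcases ih with ih | ih
        · omega
        have h1 := hstep _ hk
        have h3 : (n : ℝ) / J ≤ a (K + j) := by
          refine le_trans ?_ ih
          have : (0 : ℝ) ≤ j := by positivity
          nlinarith
        have h2 : (n : ℝ) / J ≤ ρ * a (K + j) := by nlinarith
        rw [min_eq_left h2] at h1
        rw [← add_assoc]
        push_cast
        linarith
      · left
        have := hmono (K + j)
        rw [← add_assoc]
        omega
  rcases hphase2 J with h | h
  · exact h
  · have h1 : (n : ℝ) < (1 + J) * (n / J) := by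
      rw [add_mul, mul_div_cancel₀ _ hJ0.ne']; linarith
    have h2 : (n : ℝ) < a (K + J) := h1.trans_le h
    have : n < a (K + J) := by exact_mod_cast h2
    change n < 2 * a (K + J)
    omega

/-- Two majorities share a subject k, and w k is at least w i - r and at most w j + r. -/
lemma sub_le_of_levels {n : ℕ} {w : Fin n → ℝ} {r : ℝ}
    (h1 : ∀ i, n < 2 * (upper w (w i - r)).card)
    (h2 : ∀ i, n < 2 * (upper (-w) ((-w) i - r)).card) (i j : Fin n) : w i - w j ≤ 2 * r := by
  classical
  have : ((upper w (w i - r)) ∩ (upper (-w) ((-w) j - r))).Nonempty := by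
    rw [← Finset.card_pos]
    have h3 := Finset.card_union_add_card_inter (upper w (w i - r)) (upper (-w) ((-w) j - r))
    have h4 := Finset.card_le_univ ((upper w (w i - r)) ∪ (upper (-w) ((-w) j - r)))
    rw [Fintype.card_fin] at h4
    have := h1 i
    have := h2 j
    omega
  obtain ⟨k, hk⟩ := this
  rw [Finset.mem_inter, mem_upper, mem_upper] at hk
  simp only [Pi.neg_apply] at hk
  linarith [hk.1, hk.2]

/-! ### Observed counts and orientation of cuts. -/

/-- The number of observed comparisons of a pair, as a real number. -/
def observed {n : ℕ} (T : ℕ) (N : Pair n → ℕ) (e : Pair n) : ℝ :=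
  ∑ _t : Fin T with _t.val < N e, (1 : ℝ)

lemma observed_nonneg {n : ℕ} (T : ℕ) (N : Pair n → ℕ) (e : Pair n) : 0 ≤ observed T N e :=
  Finset.sum_nonneg fun _ _ => zero_le_one

lemma observed_eq {n T : ℕ} {N : Pair n → ℕ} {e : Pair n} (h : N e ≤ T) :
    observed T N e = N e := by
  simp only [observed, Finset.sum_const, nsmul_eq_mul, mul_one, Nat.cast_inj]
  have : (Finset.univ.filter fun t : Fin T => t.val < N e) =
      Finset.univ.map (Fin.castLEEmb h) := by
    ext t
    simp only [Finset.mem_filter, Finset.mem_univ, true_and, Finset.mem_map, Fin.castLEEmb_apply]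
    constructor
    · intro ht
      exact ⟨⟨t, ht⟩, Fin.ext rfl⟩
    · rintro ⟨s, rfl⟩
      exact s.2
  rw [this]
  simp

open Classical in
/-- The orientation of a pair relative to `U`: `1` if it leaves `U`, `-1` if it enters `U`,
and `0` otherwise. -/
noncomputable def orient {n : ℕ} (U : Finset (Fin n)) (e : Pair n) : ℝ :=
  (if e.1.1 ∈ U then 1 else 0) - (if e.1.2 ∈ U then 1 else 0)

lemma orient_eq_zero {n : ℕ} {U : Finset (Fin n)} {e : Pair n} (h : e ∉ crossing U Uᶜ) :
    orient U e = 0 := by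
  simp only [mem_crossing, Finset.mem_compl, not_or, not_and, not_not] at h
  unfold orient
  by_cases h1 : e.1.1 ∈ U <;> by_cases h2 : e.1.2 ∈ U <;> simp_all

lemma abs_orient_le {n : ℕ} (U : Finset (Fin n)) (e : Pair n) : |orient U e| ≤ 1 := by
  unfold orient
  split_ifs <;> simp

lemma orient_compl {n : ℕ} (U : Finset (Fin n)) (e : Pair n) : orient Uᶜ e = -orient U e := by
  unfold orient
  by_cases h1 : e.1.1 ∈ U <;> by_cases h2 : e.1.2 ∈ U <;> simp [h1, h2]

/-! ### Deterministic analysis of the likelihood. -/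

section Likelihood

variable {A : Set ℝ} {f : ℝ → ℝ → ℝ} {n T : ℕ} {N : Pair n → ℕ} {X : Pair n → Fin T → ℝ}

lemma IsStrictlyLogConcave.strictConcaveOn (hlc : IsStrictlyLogConcave A f) {x : ℝ} (hx : x ∈ A) :
    StrictConcaveOn ℝ Set.univ fun y => Real.log (f x y) :=
  strictConcaveOn_univ_of_deriv2_neg (hlc.differentiable_log x hx).continuous
    fun y => hlc.scoreDeriv_neg x hx y

lemma logLikelihood_concave (hlc : IsStrictlyLogConcave A f) (hX : ∀ e t, X e t ∈ A)
    {a b : ℝ} (ha : 0 ≤ a) (hb : 0 ≤ b) (hab : a + b = 1) (v v' : Fin n → ℝ) :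
    a * logLikelihood f N X v + b * logLikelihood f N X v' ≤
      logLikelihood f N X (fun i => a * v i + b * v' i) := by
  unfold logLikelihood
  rw [Finset.mul_sum, Finset.mul_sum, ← Finset.sum_add_distrib]
  refine Finset.sum_le_sum fun e _ => ?_
  rw [Finset.mul_sum, Finset.mul_sum, ← Finset.sum_add_distrib]
  refine Finset.sum_le_sum fun t _ => ?_
  have := (hlc.strictConcaveOn (hX e t)).concaveOn.2 (Set.mem_univ (v e.1.1 - v e.1.2))
    (Set.mem_univ (v' e.1.1 - v' e.1.2)) ha hb hab
  simp only [smul_eq_mul] at this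
  refine this.trans_eq ?_
  congr 2
  ring

lemma logLikelihood_strict (hlc : IsStrictlyLogConcave A f) (hX : ∀ e t, X e t ∈ A)
    {v v' : Fin n → ℝ} {e : Pair n} {t : Fin T} (ht : t.val < N e)
    (hne : v e.1.1 - v e.1.2 ≠ v' e.1.1 - v' e.1.2) :
    2⁻¹ * logLikelihood f N X v + 2⁻¹ * logLikelihood f N X v' <
      logLikelihood f N X (fun i => 2⁻¹ * v i + 2⁻¹ * v' i) := by
  have key : ∀ e t, 2⁻¹ * Real.log (f (X e t) (v e.1.1 - v e.1.2)) +
      2⁻¹ * Real.log (f (X e t) (v' e.1.1 - v' e.1.2)) ≤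
      Real.log (f (X e t) ((2⁻¹ * v e.1.1 + 2⁻¹ * v' e.1.1) -
        (2⁻¹ * v e.1.2 + 2⁻¹ * v' e.1.2))) := by
    intro e t
    have := (hlc.strictConcaveOn (hX e t)).concaveOn.2 (Set.mem_univ (v e.1.1 - v e.1.2))
      (Set.mem_univ (v' e.1.1 - v' e.1.2))
      (by norm_num : (0 : ℝ) ≤ 2⁻¹) (by norm_num : (0 : ℝ) ≤ 2⁻¹) (by norm_num)
    simp only [smul_eq_mul] at this
    refine this.trans_eq ?_
    congr 2
    ring
  unfold logLikelihood
  rw [Finset.mul_sum, Finset.mul_sum, ← Finset.sum_add_distrib]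
  refine Finset.sum_lt_sum (fun e _ => ?_) ⟨e, Finset.mem_univ _, ?_⟩
  · rw [Finset.mul_sum, Finset.mul_sum, ← Finset.sum_add_distrib]
    exact Finset.sum_le_sum fun t _ => key e t
  · rw [Finset.mul_sum, Finset.mul_sum, ← Finset.sum_add_distrib]
    refine Finset.sum_lt_sum (fun t _ => key e t) ⟨t, by simpa using ht, ?_⟩
    have := (hlc.strictConcaveOn (hX e t)).2 (Set.mem_univ (v e.1.1 - v e.1.2))
      (Set.mem_univ (v' e.1.1 - v' e.1.2)) hne
      (by norm_num : (0 : ℝ) < 2⁻¹) (by norm_num : (0 : ℝ) < 2⁻¹) (by norm_num)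
    simp only [smul_eq_mul] at this
    refine this.trans_eq ?_
    congr 2
    ring

/-- If every cut is crossed by an observed comparison, the maximum likelihood estimate is unique. -/
lemma IsMLE.unique (hlc : IsStrictlyLogConcave A f) (hX : ∀ e t, X e t ∈ A)
    (hcut : ∀ S : Finset (Fin n), S.Nonempty → 2 * S.card ≤ n →
      0 < ∑ e ∈ crossing S Sᶜ, observed T N e)
    {v v' : Fin n → ℝ} (hv : IsMLE f N X v) (hv' : IsMLE f N X v') : v = v' := by
  classical
  have hedge : ∀ (e : Pair n) (t : Fin T), t.val < N e →
      v e.1.1 - v e.1.2 = v' e.1.1 - v' e.1.2 := by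
    intro e t ht
    by_contra hne
    have h1 := logLikelihood_strict hlc hX ht hne
    have hmid : (fun i => 2⁻¹ * v i + 2⁻¹ * v' i) ∈ normalized n := by
      intro i hi
      simp [hv.1 i hi, hv'.1 i hi]
    have h2 := isMaxOn_iff.1 hv.2 _ hmid
    have h3 := isMaxOn_iff.1 hv.2 _ hv'.1
    have h4 := isMaxOn_iff.1 hv'.2 _ hv.1
    linarith
  by_contra hne
  obtain ⟨i, hi⟩ := Function.ne_iff.1 hne
  have hn : 0 < n := i.pos
  -- The agreement set contains the first subject. If it is not everything, some observed comparison
  -- crosses it, and equality of the differences there carries agreement to the other side.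
  set S : Finset (Fin n) := Finset.univ.filter fun k => v k = v' k with hS
  have hS0 : S.Nonempty := ⟨⟨0, hn⟩, by simp [hS, hv.1 ⟨0, hn⟩ rfl, hv'.1 ⟨0, hn⟩ rfl]⟩
  have hSc : Sᶜ.Nonempty := ⟨i, by simp [hS, hi]⟩
  have hpos : 0 < ∑ e ∈ crossing S Sᶜ, observed T N e := by
    have hc := Finset.card_compl_add_card S
    rw [Fintype.card_fin] at hc
    by_cases h : 2 * S.card ≤ n
    · exact hcut S hS0 h
    · have := hcut Sᶜ hSc (by omega)
      rwa [compl_compl, crossing_comm] at this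
  obtain ⟨e, he, hepos⟩ := Finset.exists_lt_of_sum_lt (s := crossing S Sᶜ) (f := fun _ => (0 : ℝ))
    (by simpa using hpos)
  have : ∃ t : Fin T, t.val < N e := by
    by_contra! hno
    have : observed T N e = 0 := by
      unfold observed
      rw [Finset.filter_false_of_mem (fun t _ => not_lt.2 (hno t))]
      simp
    linarith
  obtain ⟨t, ht⟩ := this
  have heq := hedge e t ht
  simp only [mem_crossing, hS, Finset.mem_compl, Finset.mem_filter, Finset.mem_univ,
    true_and] at he
  rcases he with he | he
  · exact he.2 (by linarith [he.1])
  · exact he.1 (by linarith [he.2])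

lemma continuous_logLikelihood (hlc : IsStrictlyLogConcave A f) (hX : ∀ e t, X e t ∈ A) :
    Continuous (logLikelihood f N X) := by
  unfold logLikelihood
  refine continuous_finsetSum _ fun e _ => continuous_finsetSum _ fun t _ => ?_
  exact (hlc.differentiable_log _ (hX e t)).continuous.comp (by fun_prop)

lemma logLikelihood_sub_const (v : Fin n → ℝ) (c : ℝ) :
    logLikelihood f N X (fun i => v i - c) = logLikelihood f N X v := by
  simp [logLikelihood]

/-- The log-likelihood has a maximizer over all score vectors whose differences are within `1` of
those of `u`, and it can be chosen normalized. -/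
lemma exists_local_max (hlc : IsStrictlyLogConcave A f) (hX : ∀ e t, X e t ∈ A)
    {u : Fin n → ℝ} (hu : u ∈ normalized n) (hn : 0 < n) :
    ∃ v ∈ normalized n, (∀ i j, |(v i - u i) - (v j - u j)| ≤ 1) ∧
      ∀ v' : Fin n → ℝ, (∀ i j, |(v' i - u i) - (v' j - u j)| ≤ 1) →
        logLikelihood f N X v' ≤ logLikelihood f N X v := by
  -- Normalization turns the bound on differences into a bound on coordinates, so this set is
  -- compact. Unnormalized competitors are translated into it at no cost in likelihood.
  set B : Set (Fin n → ℝ) :=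
    {v | v ∈ normalized n ∧ ∀ i j, |(v i - u i) - (v j - u j)| ≤ 1} with hB
  have hclosed : IsClosed B := by
    have h1 : IsClosed (normalized n) := by
      have : normalized n = ⋂ i : Fin n, ⋂ _ : i.val = 0, {v | v i = 0} := by
        ext v; simp [normalized]
      rw [this]
      exact isClosed_iInter fun i => isClosed_iInter fun _ =>
        isClosed_eq (continuous_apply i) continuous_const
    have h2 : IsClosed {v : Fin n → ℝ | ∀ i j, |(v i - u i) - (v j - u j)| ≤ 1} := by
      simp only [Set.ofPred_forall]
      exact isClosed_iInter fun i => isClosed_iInter fun j =>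
        isClosed_le (by fun_prop) continuous_const
    exact h1.inter h2
  have hcompact : IsCompact B := by
    refine (isCompact_closedBall u 1).of_isClosed_subset hclosed fun v hv => ?_
    rw [Metric.mem_closedBall, dist_pi_le_iff zero_le_one]
    intro i
    have := hv.2 i ⟨0, hn⟩
    rw [hv.1 ⟨0, hn⟩ rfl, hu ⟨0, hn⟩ rfl] at this
    simpa [Real.dist_eq] using this
  obtain ⟨v, hvB, hv⟩ := hcompact.exists_isMaxOn ⟨u, hu, by simp⟩
    (continuous_logLikelihood (N := N) hlc hX).continuousOn
  refine ⟨v, hvB.1, hvB.2, fun v' hv' => ?_⟩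
  rw [← logLikelihood_sub_const v' (v' ⟨0, hn⟩)]
  refine isMaxOn_iff.1 hv _ ⟨fun i hi => ?_, fun i j => ?_⟩
  · have : i = ⟨0, hn⟩ := Fin.ext hi
    simp [this]
  · convert hv' i j using 2
    ring

open Classical in
lemma hasDerivAt_logLikelihood_shift (hlc : IsStrictlyLogConcave A f) (hX : ∀ e t, X e t ∈ A)
    (v : Fin n → ℝ) (U : Finset (Fin n)) :
    HasDerivAt (fun ε : ℝ => logLikelihood f N X fun i => v i - ε * (if i ∈ U then 1 else 0))
      (-∑ e, orient U e * ∑ t : Fin T with t.val < N e, score f (X e t) (v e.1.1 - v e.1.2)) 0 := by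
  unfold logLikelihood
  rw [← Finset.sum_neg_distrib]
  refine HasDerivAt.fun_sum fun e _ => ?_
  rw [← neg_mul, Finset.mul_sum]
  refine HasDerivAt.fun_sum fun t _ => ?_
  have h1 : HasDerivAt (fun ε : ℝ => v e.1.1 - ε * (if e.1.1 ∈ U then 1 else 0) -
      (v e.1.2 - ε * (if e.1.2 ∈ U then 1 else 0))) (-orient U e) 0 := by
    have : (fun ε : ℝ => v e.1.1 - ε * (if e.1.1 ∈ U then 1 else 0) -
      (v e.1.2 - ε * (if e.1.2 ∈ U then 1 else 0))) =
      fun ε => (v e.1.1 - v e.1.2) + ε * (-orient U e) := by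
      funext ε; unfold orient; ring
    rw [this]
    simpa using ((hasDerivAt_id (0 : ℝ)).mul_const (-orient U e)).const_add (v e.1.1 - v e.1.2)
  have h2 : HasDerivAt (fun y => Real.log (f (X e t) y))
      (score f (X e t) (v e.1.1 - v e.1.2))
      (v e.1.1 - 0 * (if e.1.1 ∈ U then 1 else 0) -
      (v e.1.2 - 0 * (if e.1.2 ∈ U then 1 else 0))) := by
    simp only [zero_mul, sub_zero]
    exact (hlc.differentiable_log _ (hX e t) _).hasDerivAt
  have := h2.comp 0 h1
  rw [mul_comm] at this
  exact this

/-- First-order optimality of the constrained maximizer against shifting an upper set down. -/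
lemma score_sum_nonneg (hlc : IsStrictlyLogConcave A f) (hX : ∀ e t, X e t ∈ A)
    {u v : Fin n → ℝ} (hv1 : ∀ i j, |(v i - u i) - (v j - u j)| ≤ 1)
    (hv : ∀ v' : Fin n → ℝ, (∀ i j, |(v' i - u i) - (v' j - u j)| ≤ 1) →
        logLikelihood f N X v' ≤ logLikelihood f N X v)
    {U : Finset (Fin n)} (hU : ∀ i ∈ U, ∀ j ∉ U, v j - u j ≤ v i - u i) :
    0 ≤ ∑ e, orient U e *
      ∑ t : Fin T with t.val < N e, score f (X e t) (v e.1.1 - v e.1.2) := by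
  classical
  -- Only the right derivative is available, because the constraint may be active at `v`.
  have hd := (hasDerivAt_logLikelihood_shift (N := N) hlc hX v U).hasDerivWithinAt
    (s := Set.Ici 0)
  rw [hasDerivWithinAt_iff_tendsto_slope] at hd
  rw [← neg_nonpos]
  have hset : Set.Ici (0 : ℝ) \ {0} = Set.Ioi 0 := by
    ext x; simp [lt_iff_le_and_ne, eq_comm]
  rw [hset] at hd
  refine le_of_tendsto hd ?_
  -- For ε in (0, 1) the shift stays admissible: the only differences that shrink are those from U
  -- to its complement, which lie in [0, 1] before the shift and in [-1, 1] after it.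
  have hmem : Set.Ioo (0 : ℝ) 1 ∈ 𝓝[>] (0 : ℝ) := Ioo_mem_nhdsGT zero_lt_one
  filter_upwards [hmem] with ε hε
  rw [slope_def_field]
  refine div_nonpos_of_nonpos_of_nonneg ?_ (by linarith [hε.1])
  rw [sub_nonpos]
  simp only [zero_mul, sub_zero]
  refine hv _ fun i j => ?_
  have hij := abs_le.1 (hv1 i j)
  rw [abs_le]
  by_cases h1 : i ∈ U <;> by_cases h2 : j ∈ U <;> simp only [h1, h2, if_true, if_false]
  · constructor <;> linarith [hij.1, hij.2]
  · have := hU i h1 j h2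
    constructor <;> linarith [hij.1, hij.2, hε.1, hε.2]
  · have := hU j h2 i h1
    constructor <;> linarith [hij.1, hij.2, hε.1, hε.2]
  · constructor <;> linarith [hij.1, hij.2]

/-- The noise in the score equation of the cut `U`. -/
noncomputable def cutNoise (f : ℝ → ℝ → ℝ) (u : Fin n → ℝ) (N : Pair n → ℕ)
    (X : Pair n → Fin T → ℝ) (U : Finset (Fin n)) : ℝ :=
  ∑ e ∈ crossing U Uᶜ,
    orient U e * ∑ t : Fin T with t.val < N e, score f (X e t) (u e.1.1 - u e.1.2)

lemma cutNoise_compl (u : Fin n → ℝ) (U : Finset (Fin n)) :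
    cutNoise f u N X Uᶜ = -cutNoise f u N X U := by
  unfold cutNoise
  rw [compl_compl, crossing_comm, ← Finset.sum_neg_distrib]
  exact Finset.sum_congr rfl fun e _ => by rw [orient_compl]; ring

/-- The oriented score sum at `v` is nonnegative, so subtracting it from the noise only decreases
the noise. Termwise the difference is a drop of the score between two points of [-(M+1), M+1], at
least c₄ times their distance; `hU` makes all the signs agree with the orientation. -/
lemma cut_deviation_le (hlc : IsStrictlyLogConcave A f) (hX : ∀ e t, X e t ∈ A)
    {u v : Fin n → ℝ} {M c₄ : ℝ} (hM : ∀ i j, |u i - u j| ≤ M)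
    (hc₄ : ∀ x ∈ A, ∀ y ∈ Set.Icc (-(M + 1)) (M + 1), ∀ y' ∈ Set.Icc (-(M + 1)) (M + 1), y ≤ y' →
      c₄ * (y' - y) ≤ score f x y - score f x y')
    (hv1 : ∀ i j, |(v i - u i) - (v j - u j)| ≤ 1)
    (hv : ∀ v' : Fin n → ℝ, (∀ i j, |(v' i - u i) - (v' j - u j)| ≤ 1) →
        logLikelihood f N X v' ≤ logLikelihood f N X v)
    {U : Finset (Fin n)} (hU : ∀ i ∈ U, ∀ j ∉ U, v j - u j ≤ v i - u i) :
    c₄ * ∑ e ∈ crossing U Uᶜ, observed T N e * |(v e.1.1 - u e.1.1) - (v e.1.2 - u e.1.2)| ≤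
      cutNoise f u N X U := by
  have h0 := score_sum_nonneg (N := N) hlc hX hv1 hv hU
  rw [← Finset.sum_subset (Finset.subset_univ (crossing U Uᶜ))
    (fun e _ he => by rw [orient_eq_zero he, zero_mul])] at h0
  suffices h : c₄ * ∑ e ∈ crossing U Uᶜ,
      observed T N e * |(v e.1.1 - u e.1.1) - (v e.1.2 - u e.1.2)| ≤
      cutNoise f u N X U - ∑ e ∈ crossing U Uᶜ, orient U e *
      ∑ t : Fin T with t.val < N e, score f (X e t) (v e.1.1 - v e.1.2) by linarith
  unfold cutNoise
  rw [← Finset.sum_sub_distrib, Finset.mul_sum]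
  refine Finset.sum_le_sum fun e he => ?_
  rw [← mul_sub, ← Finset.sum_sub_distrib, observed, Finset.sum_mul, Finset.mul_sum,
    Finset.mul_sum]
  refine Finset.sum_le_sum fun t _ => ?_
  have hub := abs_le.1 (hM e.1.1 e.1.2)
  have hwb := abs_le.1 (hv1 e.1.1 e.1.2)
  have hum : u e.1.1 - u e.1.2 ∈ Set.Icc (-(M + 1)) (M + 1) := ⟨by linarith, by linarith⟩
  have hvm : v e.1.1 - v e.1.2 ∈ Set.Icc (-(M + 1)) (M + 1) := ⟨by linarith, by linarith⟩
  have he' := mem_crossing.1 he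
  simp only [Finset.mem_compl] at he'
  rcases he' with ⟨h1, h2⟩ | ⟨h1, h2⟩
  · have hw := hU _ h1 _ h2
    have ho : orient U e = 1 := by simp [orient, h1, h2]
    rw [ho, abs_of_nonneg (by linarith)]
    have := hc₄ _ (hX e t) _ hum _ hvm (by linarith)
    linarith
  · have hw := hU _ h2 _ h1
    have ho : orient U e = -1 := by simp [orient, h1, h2]
    rw [ho, abs_of_nonpos (by linarith)]
    have := hc₄ _ (hX e t) _ hvm _ hum (by linarith)
    linarith

/-- A maximizer in the interior of the constraint set is a maximum likelihood estimate. -/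
lemma isMLE_of_interior (hlc : IsStrictlyLogConcave A f) (hX : ∀ e t, X e t ∈ A)
    {u v : Fin n → ℝ} (hvn : v ∈ normalized n) {r : ℝ} (hr : r < 1)
    (hv1 : ∀ i j, (v i - u i) - (v j - u j) ≤ r)
    (hv : ∀ v' : Fin n → ℝ, (∀ i j, |(v' i - u i) - (v' j - u j)| ≤ 1) →
        logLikelihood f N X v' ≤ logLikelihood f N X v) : IsMLE f N X v := by
  refine ⟨hvn, isMaxOn_iff.2 fun v' _ => ?_⟩
  set D : ℝ := 2 * ‖v' - v‖ with hD
  have hD0 : 0 ≤ D := by positivity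
  -- A step of size s towards `v'` changes each difference by at most s * D ≤ 1 - r, hence stays
  -- admissible. Concavity along the segment then compares `v` with `v'` itself.
  set s : ℝ := min 1 ((1 - r) / (D + 1)) with hs
  have hs0 : 0 < s := lt_min one_pos (div_pos (by linarith) (by linarith))
  have hs1 : s ≤ 1 := min_le_left _ _
  have hsD : s * D ≤ 1 - r := by
    have h1 : s * (D + 1) ≤ 1 - r := by
      rw [← le_div_iff₀ (by linarith)]; exact min_le_right _ _
    nlinarith
  have hc := logLikelihood_concave (N := N) hlc hX (a := 1 - s) (b := s) (by linarith) hs0.le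
    (by ring) v v'
  have hle := hv (fun i => (1 - s) * v i + s * v' i) fun i j => by
    have hi := norm_le_pi_norm (v' - v) i
    have hj := norm_le_pi_norm (v' - v) j
    simp only [Pi.sub_apply, Real.norm_eq_abs] at hi hj
    have hi' := abs_le.1 hi
    have hj' := abs_le.1 hj
    have e1 : (1 - s) * v i + s * v' i - u i - ((1 - s) * v j + s * v' j - u j) =
      (v i - u i - (v j - u j)) + s * ((v' i - v i) - (v' j - v j)) := by ring
    have hb1 : (v' i - v i) - (v' j - v j) ≤ D := by linarith
    have hb2 : -D ≤ (v' i - v i) - (v' j - v j) := by linarith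
    have := hv1 i j
    have := hv1 j i
    rw [e1, abs_le]
    constructor <;> nlinarith
  have : s * logLikelihood f N X v' ≤ s * logLikelihood f N X v := by linarith
  exact le_of_mul_le_mul_left this hs0

/-- Deterministic core: on graphs with expansion and with small score noise in all cuts, the
maximum likelihood estimate exists, is unique, and is close to the truth. -/
theorem exists_unique_isMLE_of_expansion (hlc : IsStrictlyLogConcave A f)
    (hX : ∀ e t, X e t ∈ A) {u : Fin n → ℝ} (hu : u ∈ normalized n) (hn : 0 < n)
    {M c₄ δ x ρ : ℝ} {J K : ℕ} (hM : ∀ i j, |u i - u j| ≤ M) (hc₄0 : 0 < c₄)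
    (hc₄ : ∀ x ∈ A, ∀ y ∈ Set.Icc (-(M + 1)) (M + 1), ∀ y' ∈ Set.Icc (-(M + 1)) (M + 1), y ≤ y' →
      c₄ * (y' - y) ≤ score f x y - score f x y')
    (hx : 0 ≤ x) (hδ : 0 < δ) (hρ : 1 ≤ ρ) (hJ : 1 ≤ J) (hK : (n : ℝ) ≤ ρ ^ K)
    (hcut : ∀ S : Finset (Fin n), S.Nonempty → 2 * S.card ≤ n →
      S.card * x / 8 < ∑ e ∈ crossing S Sᶜ, observed T N e)
    (hsmall : ∀ S R : Finset (Fin n), S.Nonempty → Disjoint S R → (R.card : ℝ) ≤ n / J →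
      (R.card : ℝ) ≤ ρ * S.card → ∑ e ∈ crossing S R, observed T N e < S.card * x / 16)
    (hnoise : ∀ S : Finset (Fin n), S.Nonempty →
      |cutNoise f u N X S| ≤ c₄ * (δ * (S.card * x / 16)))
    (hr : 2 * ((K + J : ℕ) * δ) < 1) :
    ∃ v, IsMLE f N X v ∧ (∀ v', IsMLE f N X v' → v' = v) ∧
      ‖v - u‖ ≤ 2 * ((K + J : ℕ) * δ) := by
  obtain ⟨v, hvn, hv1, hv⟩ := exists_local_max (N := N) hlc hX hu hn
  set w : Fin n → ℝ := fun i => v i - u i with hw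
  have hup : ∀ c, (upper w c).Nonempty →
      ∑ e ∈ crossing (upper w c) (upper w c)ᶜ, observed T N e * |w e.1.1 - w e.1.2| ≤
      δ * ((upper w c).card * x / 16) := by
    intro c hne
    refine le_of_mul_le_mul_left ?_ hc₄0
    refine (cut_deviation_le hlc hX hM hc₄ hv1 hv fun i hi j hj => ?_).trans
      ((le_abs_self _).trans (hnoise _ hne))
    rw [mem_upper] at hi hj
    linarith [not_le.1 hj]
  -- An upper set of -w has as complement an upper set of w. The crossing is the same and the noise
  -- only changes sign, so the bound is still in terms of the size of the upper set of -w.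
  have hdown : ∀ c, (upper (-w) c).Nonempty →
      ∑ e ∈ crossing (upper (-w) c) (upper (-w) c)ᶜ,
        observed T N e * |(-w) e.1.1 - (-w) e.1.2| ≤ δ * ((upper (-w) c).card * x / 16) := by
    intro c hne
    refine le_of_mul_le_mul_left ?_ hc₄0
    have h1 := (cut_deviation_le hlc hX hM hc₄ hv1 hv (U := (upper (-w) c)ᶜ)
      fun i hi j hj => by
        rw [Finset.mem_compl, mem_upper] at hi hj
        simp only [Pi.neg_apply, not_le] at hi hj
        linarith)
    rw [cutNoise_compl, compl_compl, crossing_comm] at h1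
    refine le_trans (le_of_eq ?_) (h1.trans ((neg_le_abs _).trans (hnoise _ hne)))
    congr 1
    refine Finset.sum_congr rfl fun e _ => ?_
    congr 1
    rw [← abs_neg]
    congr 1
    simp only [Pi.neg_apply, hw]
    ring
  have hdiff : ∀ i j, w i - w j ≤ 2 * ((K + J : ℕ) * δ) :=
    sub_le_of_levels
      (card_upper_gt_half (observed_nonneg T N) hδ hρ hJ hK hcut hsmall hup)
      (card_upper_gt_half (observed_nonneg T N) hδ hρ hJ hK hcut hsmall hdown)
  have hmle : IsMLE f N X v := isMLE_of_interior hlc hX hvn hr hdiff hv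
  refine ⟨v, hmle, fun v' hv' => IsMLE.unique hlc hX (fun S hS h2 => ?_) hv' hmle, ?_⟩
  · refine lt_of_le_of_lt ?_ (hcut S hS h2)
    positivity
  · rw [pi_norm_le_iff_of_nonneg (by positivity)]
    intro i
    have h0 : w ⟨0, hn⟩ = 0 := by simp [hw, hvn ⟨0, hn⟩ rfl, hu ⟨0, hn⟩ rfl]
    have h1 := hdiff i ⟨0, hn⟩
    have h2 := hdiff ⟨0, hn⟩ i
    rw [h0] at h1 h2
    rw [Pi.sub_apply, Real.norm_eq_abs, abs_le]
    exact ⟨by simp only [hw] at h2; linarith, by simp only [hw] at h1; linarith⟩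

end Likelihood

/-! ### Chernoff bounds for binomial multiplicities. -/

section Binomial

variable {Ω : Type*} [MeasurableSpace Ω] {P : Measure Ω} {T : ℕ} {p : unitInterval}

lemma mgf_of_hasLaw_binomial {N : Ω → ℕ} (h : HasLaw N (binomial T p) P) (θ : ℝ) :
    mgf (fun ω => (N ω : ℝ)) P θ = (1 + (p : ℝ) * (Real.exp θ - 1)) ^ T := by
  have h1 : mgf (fun ω => (N ω : ℝ)) P θ =
      ∫ k, Real.exp (θ * (k : ℝ)) ∂(binomial T p) := by
    rw [← h.map_eq, integral_map h.aemeasurable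
      (measurable_of_countable _).aestronglyMeasurable]
    rfl
  rw [h1, integral_binomial, show 1 + (p : ℝ) * (Real.exp θ - 1) =
    p * Real.exp θ + (1 - p) by ring, add_pow]
  refine Finset.sum_congr (by ext; simp) fun k _ => ?_
  rw [smul_eq_mul, mul_pow, ← Real.exp_nat_mul, mul_comm (k : ℝ) θ]
  ring

lemma mgf_binomial_le {N : Ω → ℕ} (h : HasLaw N (binomial T p) P) {θ : ℝ} (h0 : 0 ≤ θ)
    (h1 : θ ≤ 1) : mgf (fun ω => (N ω : ℝ)) P θ ≤ Real.exp (2 * θ * T * p) := by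
  have hp0 : 0 ≤ (p : ℝ) := p.2.1
  have h2 : Real.exp θ - 1 ≤ 2 * θ := by
    have := Real.abs_exp_sub_one_le (x := θ) (by rw [abs_of_nonneg h0]; exact h1)
    rw [abs_of_nonneg h0] at this
    exact (le_abs_self _).trans this
  have h3 : 0 ≤ Real.exp θ - 1 := by linarith [Real.one_le_exp h0]
  rw [mgf_of_hasLaw_binomial h]
  calc (1 + (p : ℝ) * (Real.exp θ - 1)) ^ T ≤ (Real.exp (2 * θ * p)) ^ T := by
        refine pow_le_pow_left₀ (by positivity) ?_ T
        have := Real.add_one_le_exp (2 * θ * p)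
        nlinarith
    _ = Real.exp (2 * θ * T * p) := by rw [← Real.exp_nat_mul]; ring_nf

/-- A single trial suffices: the base lies in [0, 1], so its T-th power is at most the base, and e⁻¹
≤ 1/2. -/
lemma mgf_binomial_neg_one_le {N : Ω → ℕ} (h : HasLaw N (binomial T p) P) (hT : 1 ≤ T) :
    mgf (fun ω => (N ω : ℝ)) P (-1) ≤ Real.exp (-(p : ℝ) / 2) := by
  have hp0 : 0 ≤ (p : ℝ) := p.2.1
  have hp1 : (p : ℝ) ≤ 1 := p.2.2
  have h2 : Real.exp (-1) ≤ 1 / 2 := by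
    rw [Real.exp_neg, one_div]
    refine inv_anti₀ (by norm_num) ?_
    have := Real.add_one_le_exp (1 : ℝ)
    linarith
  have h3 := Real.exp_pos (-1)
  rw [mgf_of_hasLaw_binomial h]
  have h4 : 0 ≤ 1 + (p : ℝ) * (Real.exp (-1) - 1) := by nlinarith
  have h5 : 1 + (p : ℝ) * (Real.exp (-1) - 1) ≤ 1 := by nlinarith
  refine (pow_le_of_le_one h4 h5 (by omega)).trans ?_
  have := Real.add_one_le_exp (-(p : ℝ) / 2)
  nlinarith

variable {ι : Type*} {N : ι → Ω → ℕ}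

lemma iIndepFun_cast (hN : iIndepFun N P) : iIndepFun (fun e ω => (N e ω : ℝ)) P :=
  hN.comp (fun _ k => (k : ℝ)) fun _ => measurable_of_countable _

lemma aemeasurable_cast (hlaw : ∀ e, HasLaw (N e) (binomial T p) P) (e : ι) :
    AEMeasurable (fun ω => (N e ω : ℝ)) P :=
  (measurable_of_countable (fun k : ℕ => (k : ℝ))).comp_aemeasurable (hlaw e).aemeasurable

lemma integrable_exp_sum [IsProbabilityMeasure P]
    (hlaw : ∀ e, HasLaw (N e) (binomial T p) P) (s : Finset ι) (θ : ℝ) :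
    Integrable (fun ω => Real.exp (θ * ∑ e ∈ s, (N e ω : ℝ))) P := by
  refine integrable_exp_mul_of_mem_Icc (a := 0) (b := s.card * T)
    (Finset.aemeasurable_fun_sum s fun e _ => aemeasurable_cast hlaw e) ?_
  have h := (s.eventually_all (l := ae P) (p := fun e ω => N e ω ≤ T)).2
    fun e _ => ae_le_of_hasLaw_binomial (hlaw e)
  filter_upwards [h] with ω hω
  refine ⟨by positivity, ?_⟩
  rw [← nsmul_eq_mul]
  exact Finset.sum_le_card_nsmul _ _ _ fun e he => by exact_mod_cast hω e he

lemma mgf_sum_cast (hlaw : ∀ e, HasLaw (N e) (binomial T p) P) (hN : iIndepFun N P)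
    (s : Finset ι) (θ : ℝ) :
    mgf (fun ω => ∑ e ∈ s, (N e ω : ℝ)) P θ = ∏ e ∈ s, mgf (fun ω => (N e ω : ℝ)) P θ := by
  rw [← (iIndepFun_cast hN).mgf_sum₀ (aemeasurable_cast hlaw) s]
  congr 1
  ext ω
  simp

lemma mgf_sum_binomial_le (hlaw : ∀ e, HasLaw (N e) (binomial T p) P) (hN : iIndepFun N P)
    (s : Finset ι) {θ : ℝ} (h0 : 0 ≤ θ) (h1 : θ ≤ 1) :
    mgf (fun ω => ∑ e ∈ s, (N e ω : ℝ)) P θ ≤ Real.exp (2 * θ * T * p * s.card) := by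
  rw [mgf_sum_cast hlaw hN]
  refine (Finset.prod_le_prod (fun e _ => mgf_nonneg) fun e _ =>
    mgf_binomial_le (hlaw e) h0 h1).trans_eq ?_
  rw [Finset.prod_const, ← Real.exp_nat_mul]
  ring_nf

lemma measure_sum_binomial_ge_le [IsProbabilityMeasure P]
    (hlaw : ∀ e, HasLaw (N e) (binomial T p) P)
    (hN : iIndepFun N P) (s : Finset ι) (b : ℝ) :
    P.real {ω | b ≤ ∑ e ∈ s, (N e ω : ℝ)} ≤ Real.exp (-b + 2 * T * p * s.card) := by
  refine (measure_ge_le_exp_mul_mgf b zero_le_one (integrable_exp_sum hlaw s 1)).trans ?_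
  rw [Real.exp_add, neg_one_mul]
  refine mul_le_mul_of_nonneg_left ?_ (Real.exp_pos _).le
  simpa using mgf_sum_binomial_le hlaw hN s zero_le_one le_rfl

lemma measure_sum_binomial_le_le [IsProbabilityMeasure P]
    (hlaw : ∀ e, HasLaw (N e) (binomial T p) P) (hT : 1 ≤ T)
    (hN : iIndepFun N P) (s : Finset ι) (b : ℝ) :
    P.real {ω | ∑ e ∈ s, (N e ω : ℝ) ≤ b} ≤ Real.exp (b - p * s.card / 2) := by
  refine (measure_le_le_exp_mul_mgf b (by norm_num : (-1 : ℝ) ≤ 0)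
    (integrable_exp_sum hlaw s (-1))).trans ?_
  rw [sub_eq_add_neg, Real.exp_add, neg_neg, one_mul]
  refine mul_le_mul_of_nonneg_left ?_ (Real.exp_pos _).le
  rw [mgf_sum_cast hlaw hN]
  refine (Finset.prod_le_prod (fun e _ => mgf_nonneg) fun e _ =>
    mgf_binomial_neg_one_le (hlaw e) hT).trans_eq ?_
  rw [Finset.prod_const, ← Real.exp_nat_mul]
  ring_nf

end Binomial

/-! ### Concentration of the observed score sums. -/

section Noise

variable {Ω : Type*} [MeasurableSpace Ω] {P : Measure Ω} [IsProbabilityMeasure P] {T : ℕ}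
  {p : unitInterval} {ι : Type*} {N : ι → Ω → ℕ} {Y : ι × Fin T → Ω → ℝ}

open Classical in
/-- The sum of the variables `y (e, t)` with `e ∈ s` and `t < k e`, with weights `σ e`. -/
noncomputable def observedSum (s : Finset ι) (σ : ι → ℝ) (k : ι → ℕ) (y : ι × Fin T → ℝ) : ℝ :=
  ∑ q ∈ s ×ˢ Finset.univ with q.2.val < k q.1, σ q.1 * y q

lemma observedSum_eq (s : Finset ι) (σ : ι → ℝ) (k : ι → ℕ) (y : ι × Fin T → ℝ) :
    observedSum s σ k y = ∑ e ∈ s, σ e * ∑ t : Fin T with t.val < k e, y (e, t) := by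
  classical
  unfold observedSum
  rw [Finset.sum_filter, Finset.sum_product]
  refine Finset.sum_congr rfl fun e _ => ?_
  rw [Finset.mul_sum, Finset.sum_filter]

lemma measurable_observedSum (s : Finset ι) (σ : ι → ℝ) :
    Measurable fun z : (ι → ℕ) × (ι × Fin T → ℝ) => observedSum s σ z.1 z.2 := by
  classical
  unfold observedSum
  simp_rw [Finset.sum_filter]
  refine Finset.measurable_fun_sum _ fun q _ => Measurable.ite ?_ (by fun_prop) measurable_const
  exact measurableSet_lt measurable_const (by fun_prop)

/-- The multiplicities are frozen here. By Hoeffding's lemma each weighted term is sub-Gaussian with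
parameter C², and at most the sum of the `k e` independent terms occur. -/
lemma mgf_observedSum_le (hY : ∀ q, AEMeasurable (Y q) P) {C : ℝ}
    (hC : ∀ q, ∀ᵐ ω ∂P, Y q ω ∈ Set.Icc (-C) C) (hmean : ∀ q, ∫ ω, Y q ω ∂P = 0)
    (hind : iIndepFun Y P) {σ : ι → ℝ} (hσ : ∀ e, |σ e| ≤ 1) (hC0 : 0 ≤ C)
    (s : Finset ι) (k : ι → ℕ) (l : ℝ) :
    Integrable (fun ω => Real.exp (l * observedSum s σ k fun q => Y q ω)) P ∧
    ∫ ω, Real.exp (l * observedSum s σ k fun q => Y q ω) ∂P ≤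
      Real.exp (l ^ 2 * C ^ 2 / 2 * ∑ e ∈ s, (k e : ℝ)) := by
  classical
  have hsub : ∀ q, HasSubgaussianMGF (fun ω => σ q.1 * Y q ω) (C.toNNReal ^ 2) P := by
    intro q
    have h := hasSubgaussianMGF_of_mem_Icc_of_integral_eq_zero (X := fun ω => σ q.1 * Y q ω)
      (a := -C) (b := C) ((hY q).const_mul _) (by
        filter_upwards [hC q] with ω hω
        rw [Set.mem_Icc, ← abs_le] at hω ⊢
        rw [abs_mul]
        calc |σ q.1| * |Y q ω| ≤ 1 * C := mul_le_mul (hσ _) hω (abs_nonneg _) zero_le_one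
          _ = C := one_mul C) (by rw [integral_const_mul, hmean, mul_zero])
    convert h using 2
    apply NNReal.eq
    simp only [NNReal.coe_div, coe_nnnorm, Real.norm_eq_abs, NNReal.coe_ofNat,
      Real.coe_toNNReal C hC0]
    rw [abs_of_nonneg (by linarith)]
    ring
  have hind' : iIndepFun (fun q ω => σ q.1 * Y q ω) P :=
    hind.comp (fun q y => σ q.1 * y) fun q => by fun_prop
  have hs := HasSubgaussianMGF.sum_of_iIndepFun hind'
    (s := (s ×ˢ Finset.univ).filter fun q : ι × Fin T => q.2.val < k q.1)
    (c := fun _ => C.toNNReal ^ 2) fun q _ => hsub q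
  refine ⟨hs.integrable_exp_mul l, (hs.mgf_le l).trans ?_⟩
  rw [Real.exp_le_exp, Finset.sum_const, nsmul_eq_mul]
  have hcard : (((s ×ˢ Finset.univ).filter fun q : ι × Fin T => q.2.val < k q.1).card : ℝ) ≤
      ∑ e ∈ s, (k e : ℝ) := by
    rw [Finset.card_filter, Finset.sum_product]
    push_cast
    refine Finset.sum_le_sum fun e _ => ?_
    have : (Finset.univ.filter fun t : Fin T => t.val < k e).card ≤ k e := by
      have := Finset.card_le_card_of_injOn (s := Finset.univ.filter fun t : Fin T => t.val < k e)
        (t := Finset.range (k e)) Fin.val (fun t ht => by simpa using ht)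
        (fun a _ b _ h => Fin.ext h)
      simpa using this
    rw [Finset.card_filter] at this
    exact_mod_cast this
  push_cast
  rw [Real.coe_toNNReal C hC0]
  have := mul_le_mul_of_nonneg_left hcard (show 0 ≤ l ^ 2 * C ^ 2 / 2 by positivity)
  linarith

/-- Bernstein-type bound for sums of centred bounded variables observed a binomial number of
times. -/
lemma measure_observedSum_ge_le [Fintype ι] (hlaw : ∀ e, HasLaw (N e) (binomial T p) P)
    (hN : iIndepFun N P) (hY : ∀ q, AEMeasurable (Y q) P) {C : ℝ} (hC0 : 0 ≤ C)
    (hC : ∀ q, ∀ᵐ ω ∂P, Y q ω ∈ Set.Icc (-C) C) (hmean : ∀ q, ∫ ω, Y q ω ∂P = 0)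
    (hind : iIndepFun Y P) (hNY : IndepFun (fun ω e => N e ω) (fun ω q => Y q ω) P)
    {σ : ι → ℝ} (hσ : ∀ e, |σ e| ≤ 1) (s : Finset ι) (b : ℝ) {l : ℝ} (hl : 0 ≤ l)
    (hl1 : l ^ 2 * C ^ 2 / 2 ≤ 1) :
    P.real {ω | b ≤ observedSum s σ (fun e => N e ω) fun q => Y q ω} ≤
      Real.exp (-l * b + l ^ 2 * C ^ 2 * T * p * s.card) := by
  set F : (ι → ℕ) × (ι × Fin T → ℝ) → ℝ≥0∞ :=
    fun z => ENNReal.ofReal (Real.exp (l * observedSum s σ z.1 z.2)) with hF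
  have hFm : Measurable F :=
    ((measurable_observedSum s σ).const_mul l).exp.ennreal_ofReal
  have hNm : AEMeasurable (fun ω e => N e ω) P :=
    aemeasurable_pi_lambda _ fun e => (hlaw e).aemeasurable
  have hYm : AEMeasurable (fun ω q => Y q ω) P := aemeasurable_pi_lambda _ hY
  have hprod := (indepFun_iff_map_prod_eq_prod_map_map hNm hYm).1 hNY
  have : IsProbabilityMeasure (P.map fun ω q => Y q ω) := Measure.isProbabilityMeasure_map hYm
  have : IsProbabilityMeasure (P.map fun ω e => N e ω) := Measure.isProbabilityMeasure_map hNm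
  have hGm : Measurable fun k : ι → ℕ =>
      ENNReal.ofReal (Real.exp (l ^ 2 * C ^ 2 / 2 * ∑ e ∈ s, (k e : ℝ))) := by
    refine ((Finset.measurable_fun_sum _ fun e _ => ?_).const_mul _).exp.ennreal_ofReal
    exact (measurable_of_countable (fun k : ℕ => (k : ℝ))).comp (measurable_pi_apply e)
  -- Independence allows integrating the outcomes first with the multiplicities fixed. What remains
  -- is the moment generating function of a binomial sum at l²C²/2, which `hl1` keeps in [0, 1].
  -- Working with lower integrals lets integrability follow from the bound.
  have key : ∫⁻ ω, F (fun e => N e ω, fun q => Y q ω) ∂P ≤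
      ENNReal.ofReal (Real.exp (l ^ 2 * C ^ 2 * T * p * s.card)) := by
    calc ∫⁻ ω, F (fun e => N e ω, fun q => Y q ω) ∂P
        = ∫⁻ z, F z ∂(P.map fun ω => ((fun e => N e ω), fun q => Y q ω)) :=
          (lintegral_map' hFm.aemeasurable (hNm.prodMk hYm)).symm
      _ = ∫⁻ k, ∫⁻ y, F (k, y) ∂(P.map fun ω q => Y q ω) ∂(P.map fun ω e => N e ω) := by
          rw [hprod, lintegral_prod _ hFm.aemeasurable]
      _ ≤ ∫⁻ k, ENNReal.ofReal (Real.exp (l ^ 2 * C ^ 2 / 2 * ∑ e ∈ s, (k e : ℝ)))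
            ∂(P.map fun ω e => N e ω) := by
          refine lintegral_mono fun k => ?_
          have hk := mgf_observedSum_le hY hC hmean hind hσ hC0 s k l
          have hFk : Measurable fun y => F (k, y) := hFm.comp measurable_prodMk_left
          rw [lintegral_map' hFk.aemeasurable hYm]
          simp only [hF]
          rw [← ofReal_integral_eq_lintegral_ofReal hk.1 (ae_of_all _ fun _ => (Real.exp_pos _).le)]
          exact ENNReal.ofReal_le_ofReal hk.2
      _ = ∫⁻ ω, ENNReal.ofReal (Real.exp (l ^ 2 * C ^ 2 / 2 * ∑ e ∈ s, (N e ω : ℝ))) ∂P :=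
          lintegral_map' hGm.aemeasurable hNm
      _ = ENNReal.ofReal (mgf (fun ω => ∑ e ∈ s, (N e ω : ℝ)) P (l ^ 2 * C ^ 2 / 2)) := by
          rw [← ofReal_integral_eq_lintegral_ofReal (integrable_exp_sum hlaw s _)
            (ae_of_all _ fun _ => (Real.exp_pos _).le)]
          rfl
      _ ≤ _ := by
          refine ENNReal.ofReal_le_ofReal
            ((mgf_sum_binomial_le hlaw hN s (by positivity) hl1).trans_eq ?_)
          ring_nf
  have hWm : AEMeasurable (fun ω => Real.exp (l * observedSum s σ (fun e => N e ω)
      fun q => Y q ω)) P :=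
    (((measurable_observedSum s σ).comp_aemeasurable (hNm.prodMk hYm)).const_mul l).exp
  have hint : Integrable (fun ω => Real.exp (l * observedSum s σ (fun e => N e ω)
      fun q => Y q ω)) P := by
    refine ⟨hWm.aestronglyMeasurable, ?_⟩
    rw [hasFiniteIntegral_iff_ofReal (ae_of_all _ fun _ => (Real.exp_pos _).le)]
    exact key.trans_lt ENNReal.ofReal_lt_top
  refine (measure_ge_le_exp_mul_mgf b hl hint).trans ?_
  rw [Real.exp_add]
  refine mul_le_mul_of_nonneg_left ?_ (Real.exp_pos _).le
  unfold mgf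
  rw [integral_eq_lintegral_of_nonneg_ae (ae_of_all _ fun _ => (Real.exp_pos _).le)
    hWm.aestronglyMeasurable]
  exact ENNReal.toReal_le_of_le_ofReal (Real.exp_pos _).le key

end Noise

/-! ### Union bounds over all cuts. -/

section UnionBound

variable {Ω : Type*} [MeasurableSpace Ω] {P : Measure Ω}

lemma measureReal_exists_le {ι : Type*} (s : Finset ι) (B : ι → Ω → Prop) (b : ι → ℝ)
    (h : ∀ i ∈ s, P.real {ω | B i ω} ≤ b i) :
    P.real {ω | ∃ i ∈ s, B i ω} ≤ ∑ i ∈ s, b i := by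
  have : {ω | ∃ i ∈ s, B i ω} = ⋃ i ∈ s, {ω | B i ω} := by ext; simp
  rw [this]
  exact (measureReal_biUnion_finset_le s _).trans (Finset.sum_le_sum h)

lemma one_add_pow_le {n : ℕ} (hn : 1 ≤ n) :
    (1 + Real.exp (-(3 * Real.log n))) ^ n ≤ 1 + 2 / (n : ℝ) ^ 2 := by
  have hn0 : (0 : ℝ) < n := by exact_mod_cast hn
  have hn1 : (1 : ℝ) ≤ n := by exact_mod_cast hn
  have hq : Real.exp (-(3 * Real.log n)) = 1 / (n : ℝ) ^ 3 := by
    rw [Real.exp_neg, mul_comm, Real.exp_mul, Real.exp_log hn0, one_div]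
    norm_cast
  rw [hq]
  have hy : (n : ℝ) * (1 / (n : ℝ) ^ 3) = 1 / (n : ℝ) ^ 2 := by field_simp
  have hy0 : 0 ≤ 1 / (n : ℝ) ^ 2 := by positivity
  have hy1 : 1 / (n : ℝ) ^ 2 ≤ 1 := by
    rw [div_le_one (by positivity)]; exact one_le_pow₀ hn1
  calc (1 + 1 / (n : ℝ) ^ 3) ^ n ≤ (Real.exp (1 / (n : ℝ) ^ 3)) ^ n := by
        refine pow_le_pow_left₀ (by positivity) ?_ n
        linarith [Real.add_one_le_exp (1 / (n : ℝ) ^ 3)]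
    _ = Real.exp (1 / (n : ℝ) ^ 2) := by rw [← Real.exp_nat_mul, hy]
    _ ≤ 1 + 2 / (n : ℝ) ^ 2 := by
        have := Real.abs_exp_sub_one_le (x := 1 / (n : ℝ) ^ 2) (by rwa [abs_of_nonneg hy0])
        rw [abs_of_nonneg hy0] at this
        have h2 := (le_abs_self _).trans this
        have h3 : 2 / (n : ℝ) ^ 2 = 2 * (1 / (n : ℝ) ^ 2) := by ring
        linarith

/-- With weight n⁻³ per member, the sum over all subsets is a binomial expansion. The empty set
contributes the 1, so nonempty sets cost only 2/n². -/
lemma sum_exp_card (n : ℕ) :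
    ∑ S : Finset (Fin n), Real.exp (-(3 * Real.log n) * S.card) =
      (1 + Real.exp (-(3 * Real.log n))) ^ n := by
  have := Finset.sum_pow_mul_eq_add_pow (Real.exp (-(3 * Real.log n))) 1
    (Finset.univ : Finset (Fin n))
  rw [Finset.powerset_univ, Finset.card_univ, Fintype.card_fin] at this
  rw [add_comm, ← this]
  refine Finset.sum_congr rfl fun S _ => ?_
  rw [one_pow, mul_one, mul_comm, Real.exp_nat_mul]

lemma sum_exp_card_nonempty_le {n : ℕ} (hn : 1 ≤ n) :
    ∑ S : Finset (Fin n) with S.Nonempty, Real.exp (-(3 * Real.log n) * S.card) ≤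
      2 / (n : ℝ) ^ 2 := by
  have h := sum_exp_card n
  rw [← Finset.sum_filter_add_sum_filter_not Finset.univ Finset.Nonempty] at h
  have h2 : ∑ S : Finset (Fin n) with ¬S.Nonempty, Real.exp (-(3 * Real.log n) * S.card) = 1 := by
    have : (Finset.univ.filter fun S : Finset (Fin n) => ¬S.Nonempty) = {∅} := by
      ext S; simp
    rw [this]
    simp
  linarith [one_add_pow_le hn]

variable [IsProbabilityMeasure P] {n T : ℕ} {p : unitInterval} {N : Pair n → Ω → ℕ}

/-- Every cut is crossed by many observed comparisons. -/
lemma measure_sparse_cut_le (hlaw : ∀ e, HasLaw (N e) (binomial T p) P) (hN : iIndepFun N P)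
    (hT : 1 ≤ T) (hn : 1 ≤ n) (hx : 24 * Real.log n ≤ n * (p : ℝ)) :
    P.real {ω | ∃ S ∈ Finset.univ.filter fun S : Finset (Fin n) => S.Nonempty,
      2 * S.card ≤ n ∧ ∑ e ∈ crossing S Sᶜ, (N e ω : ℝ) ≤ S.card * (n * (p : ℝ)) / 8} ≤
      2 / (n : ℝ) ^ 2 := by
  refine (measureReal_exists_le _ _ (fun S => Real.exp (-(3 * Real.log n) * S.card))
    fun S _ => ?_).trans (sum_exp_card_nonempty_le hn)
  by_cases hS : 2 * S.card ≤ n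
  · simp only [hS, true_and]
    -- As |Sᶜ| ≥ n/2, the exponent is at most |S|x/8 - |S|x/4 = -|S|x/8 with x = np, and x ≥ 24 log
    -- n makes this at most -3|S| log n.
    refine (measure_sum_binomial_le_le hlaw hT hN _ _).trans ?_
    rw [Real.exp_le_exp, card_crossing disjoint_compl_right, Finset.card_compl, Fintype.card_fin,
      Nat.cast_mul, Nat.cast_sub (by omega)]
    have hS' : 2 * (S.card : ℝ) ≤ n := by exact_mod_cast hS
    have hs0 : (0 : ℝ) ≤ S.card := by positivity
    have hp0 : 0 ≤ (p : ℝ) := p.2.1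
    have h1 : 0 ≤ (p : ℝ) * S.card * (n - 2 * S.card) :=
      mul_nonneg (mul_nonneg hp0 hs0) (by linarith)
    have h2 := mul_le_mul_of_nonneg_left hx hs0
    nlinarith
  · simp only [hS, false_and, Set.ofPred_false, measureReal_empty]
    exact (Real.exp_pos _).le

/-- Few comparisons are observed between a set and a set which is not much larger. -/
lemma measure_dense_pair_le (hlaw : ∀ e, HasLaw (N e) (binomial T p) P) (hN : iIndepFun N P)
    (hT : 1 ≤ T) (hn : 2 ≤ n) (hx : 320 * Real.log n ≤ n * (p : ℝ)) :
    P.real {ω | ∃ z ∈ (Finset.univ.filter fun S : Finset (Fin n) => S.Nonempty) ×ˢ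
        (Finset.univ : Finset (Finset (Fin n))),
      (Disjoint z.1 z.2 ∧ (z.2.card : ℝ) ≤ n / (64 * T : ℕ) ∧
        (z.2.card : ℝ) ≤ n * (p : ℝ) / (320 * Real.log n) * z.1.card) ∧
      z.1.card * (n * (p : ℝ)) / 16 ≤ ∑ e ∈ crossing z.1 z.2, (N e ω : ℝ)} ≤
      3 / (n : ℝ) ^ 2 := by
  have hn2 : (2 : ℝ) ≤ n := by exact_mod_cast hn
  have hL : 0 < Real.log n := Real.log_pos (by linarith)
  have hT0 : (0 : ℝ) < T := by exact_mod_cast hT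
  refine (measureReal_exists_le _ _ (fun z => Real.exp (-(3 * Real.log n) * z.1.card) *
    Real.exp (-(3 * Real.log n) * z.2.card)) fun z _ => ?_).trans ?_
  · by_cases hz : Disjoint z.1 z.2 ∧ (z.2.card : ℝ) ≤ n / (64 * T : ℕ) ∧
        (z.2.card : ℝ) ≤ n * (p : ℝ) / (320 * Real.log n) * z.1.card
    · simp only [hz, true_and]
      -- With x = np, |R| ≤ n/(64T) bounds the mean term by |S|x/32, leaving -|S|x/32. Both |S| log
      -- n and |R| log n are at most |S|x/320, so 3(|S| + |R|) log n fits.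
      refine (measure_sum_binomial_ge_le hlaw hN _ _).trans ?_
      rw [← Real.exp_add, Real.exp_le_exp, card_crossing hz.1, Nat.cast_mul]
      have hs0 : (0 : ℝ) ≤ z.1.card := by positivity
      have hr0 : (0 : ℝ) ≤ z.2.card := by positivity
      have hp0 : 0 ≤ (p : ℝ) := p.2.1
      obtain ⟨-, h1, h2⟩ := hz
      rw [Nat.cast_mul, Nat.cast_ofNat, le_div_iff₀ (by positivity)] at h1
      rw [div_mul_eq_mul_div, le_div_iff₀ (by positivity)] at h2
      have h3 := mul_le_mul_of_nonneg_left h1 (mul_nonneg hp0 hs0)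
      have h4 := mul_le_mul_of_nonneg_left hx hs0
      nlinarith
    · simp only [hz, false_and, Set.ofPred_false, measureReal_empty]
      positivity
  · rw [Finset.sum_product]
    dsimp only
    rw [← Finset.sum_mul_sum, sum_exp_card]
    have h1 := sum_exp_card_nonempty_le (n := n) (by omega)
    have h2 := one_add_pow_le (n := n) (by omega)
    have h3 : 2 / (n : ℝ) ^ 2 ≤ 1 / 2 := by
      rw [div_le_div_iff₀ (by positivity) (by norm_num)]; nlinarith
    calc _ ≤ 2 / (n : ℝ) ^ 2 * (3 / 2) := by
          refine mul_le_mul h1 (by linarith) (by positivity) (by positivity)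
      _ = 3 / (n : ℝ) ^ 2 := by ring

/-- The centred sums over all cuts are simultaneously small. -/
lemma measure_large_noise_le (hlaw : ∀ e, HasLaw (N e) (binomial T p) P) (hN : iIndepFun N P)
    {Y : Pair n × Fin T → Ω → ℝ}
    (hY : ∀ q, AEMeasurable (Y q) P) {C : ℝ} (hC0 : 0 < C)
    (hC : ∀ q, ∀ᵐ ω ∂P, Y q ω ∈ Set.Icc (-C) C) (hmean : ∀ q, ∫ ω, Y q ω ∂P = 0)
    (hind : iIndepFun Y P) (hNY : IndepFun (fun ω e => N e ω) (fun ω q => Y q ω) P)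
    (hn : 2 ≤ n) (hx : Real.log n ≤ n * (p : ℝ)) :
    P.real {ω | ∃ S ∈ Finset.univ.filter fun S : Finset (Fin n) => S.Nonempty,
      (T + 3) * C * √(Real.log n * (n * (p : ℝ))) * S.card <
        |observedSum (crossing S Sᶜ) (orient S) (fun e => N e ω) fun q => Y q ω|} ≤
      4 / (n : ℝ) ^ 2 := by
  have hn2 : (2 : ℝ) ≤ n := by exact_mod_cast hn
  have hL : 0 < Real.log n := Real.log_pos (by linarith)
  set L := Real.log n with hLdef
  set x := (n : ℝ) * (p : ℝ) with hxdef
  have hx0 : 0 < x := hL.trans_le hx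
  -- This l gives l²C² = L/x: the linear term is -(T+3)L|S|, the quadratic one at most TL|S|, and
  -- -3L|S| remains.
  set l := √(L / x) / C with hl
  have hl0 : 0 ≤ l := by positivity
  have hlC : l ^ 2 * C ^ 2 = L / x := by
    rw [hl, div_pow, div_mul_cancel₀ _ (by positivity), Real.sq_sqrt (by positivity)]
  have hl1 : l ^ 2 * C ^ 2 / 2 ≤ 1 := by
    rw [hlC]
    have : L / x ≤ 1 := (div_le_one hx0).2 hx
    linarith
  have hlsq : l * (C * √(L * x)) = L := by
    have : √(L / x) * √(L * x) = L := by
      rw [← Real.sqrt_mul (by positivity), show L / x * (L * x) = L ^ 2 by field_simp,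
        Real.sqrt_sq hL.le]
    rw [hl]
    calc √(L / x) / C * (C * √(L * x)) = √(L / x) * √(L * x) := by field_simp
      _ = L := this
  have hone : ∀ σ : Pair n → ℝ, (∀ e, |σ e| ≤ 1) → ∀ S : Finset (Fin n),
      P.real {ω | (T + 3) * C * √(L * x) * S.card ≤
        observedSum (crossing S Sᶜ) σ (fun e => N e ω) fun q => Y q ω} ≤
      Real.exp (-(3 * L) * S.card) := by
    intro σ hσ S
    refine (measure_observedSum_ge_le hlaw hN hY hC0.le hC hmean hind hNY hσ _ _ hl0 hl1).trans ?_
    rw [Real.exp_le_exp, card_crossing disjoint_compl_right, hlC, Nat.cast_mul]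
    have h1 : -l * ((T + 3) * C * √(L * x) * S.card) = -((T + 3) * L * S.card) := by
      calc _ = -((T + 3) * (l * (C * √(L * x))) * S.card) := by ring
        _ = _ := by rw [hlsq]
    have hcle : ((Sᶜ).card : ℝ) ≤ n := by
      have := Finset.card_le_univ Sᶜ
      rw [Fintype.card_fin] at this
      exact_mod_cast this
    have hp0 : 0 ≤ (p : ℝ) := p.2.1
    have h2 : L / x * T * p * (S.card * (Sᶜ).card) ≤ L / x * T * p * (S.card * n) := by gcongr
    have h3 : L / x * T * p * (S.card * n) = T * L * S.card := by
      calc L / x * T * p * (S.card * n) = L / x * x * (T * S.card) := by rw [hxdef]; ring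
        _ = T * L * S.card := by rw [div_mul_cancel₀ _ hx0.ne']; ring
    rw [h1]
    linarith
  calc _ ≤ ∑ S : Finset (Fin n) with S.Nonempty, 2 * Real.exp (-(3 * L) * S.card) := by
        refine measureReal_exists_le _ _ _ fun S _ => ?_
        have hsub : {ω | (T + 3) * C * √(L * x) * S.card <
            |observedSum (crossing S Sᶜ) (orient S) (fun e => N e ω) fun q => Y q ω|} ⊆
          {ω | (T + 3) * C * √(L * x) * S.card ≤
            observedSum (crossing S Sᶜ) (orient S) (fun e => N e ω) fun q => Y q ω} ∪
          {ω | (T + 3) * C * √(L * x) * S.card ≤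
            observedSum (crossing S Sᶜ) (-orient S) (fun e => N e ω) fun q => Y q ω} := by
          intro ω hω
          rcases lt_abs.1 (Set.mem_ofPred_eq ▸ hω) with h | h
          · exact Or.inl h.le
          · refine Or.inr (h.le.trans_eq ?_)
            simp [observedSum]
        refine (measureReal_mono hsub).trans ((measureReal_union_le _ _).trans ?_)
        rw [two_mul]
        exact add_le_add (hone _ (abs_orient_le S) S)
          (hone _ (fun e => by rw [Pi.neg_apply, abs_neg]; exact abs_orient_le S e) S)
    _ ≤ 4 / (n : ℝ) ^ 2 := by
        rw [← Finset.mul_sum]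
        have := sum_exp_card_nonempty_le (n := n) (by omega)
        calc _ ≤ 2 * (2 / (n : ℝ) ^ 2) := by linarith
          _ = _ := by ring

end UnionBound

/-! ### Integral identities for the comparison density. -/

section Density

variable {A : Set ℝ} {ν : Measure ℝ} {f : ℝ → ℝ → ℝ}

lemma IsValid.ae_mem (hf : IsValid A ν f) : ∀ᵐ x ∂ν.restrict A, x ∈ A :=
  ae_restrict_mem hf.measurableSet

lemma IsValid.ae_nonneg (hf : IsValid A ν f) (y : ℝ) : 0 ≤ᵐ[ν.restrict A] fun x => f x y := by
  filter_upwards [hf.ae_mem] with x hx using hf.nonneg x hx y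

lemma IsValid.integrable (hf : IsValid A ν f) (y : ℝ) :
    Integrable (fun x => f x y) (ν.restrict A) := by
  refine ⟨(hf.aemeasurable y).aestronglyMeasurable, ?_⟩
  rw [hasFiniteIntegral_iff_ofReal (hf.ae_nonneg y), hf.lintegral_eq_one y]
  exact ENNReal.one_lt_top

lemma IsValid.integral_eq_one (hf : IsValid A ν f) (y : ℝ) : ∫ x in A, f x y ∂ν = 1 := by
  rw [integral_eq_lintegral_of_nonneg_ae (hf.ae_nonneg y) (hf.integrable y).1,
    hf.lintegral_eq_one y, ENNReal.toReal_one]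

/-- For fixed y the score is an almost everywhere limit of difference quotients in y, each of which
is measurable in x. -/
lemma IsValid.aemeasurable_score (hf : IsValid A ν f) (hlc : IsStrictlyLogConcave A f) (y : ℝ) :
    AEMeasurable (fun x => score f x y) (ν.restrict A) := by
  refine aemeasurable_of_tendsto_metrizable_ae atTop
    (f := fun (k : ℕ) x => ((1 : ℝ) / (k + 1))⁻¹ *
      (Real.log (f x (y + 1 / (k + 1))) - Real.log (f x y))) (fun k => ?_) ?_
  · exact (((Real.measurable_log.comp_aemeasurable (hf.aemeasurable _)).sub
      (Real.measurable_log.comp_aemeasurable (hf.aemeasurable _))).const_mul _)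
  · filter_upwards [hf.ae_mem] with x hx
    have h := (hlc.differentiable_log x hx y).hasDerivAt.tendsto_slope_zero
    have hk : Tendsto (fun k : ℕ => (1 : ℝ) / (k + 1)) atTop (𝓝[≠] 0) :=
      tendsto_nhdsWithin_of_tendsto_nhds_of_eventually_within _
        tendsto_one_div_add_atTop_nhds_zero_nat
        (Eventually.of_forall fun k => by
          have : (0 : ℝ) < 1 / (k + 1) := by positivity
          exact this.ne')
    exact h.comp hk

lemma IsStrictlyLogConcave.hasDerivAt (hlc : IsStrictlyLogConcave A f) {x : ℝ} (hx : x ∈ A)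
    (y : ℝ) : HasDerivAt (f x) (score f x y * f x y) y := by
  have h := (hlc.differentiable_log x hx y).hasDerivAt.exp
  have he : (fun z => Real.exp (Real.log (f x z))) = f x :=
    funext fun z => Real.exp_log (hlc.pos x hx z)
  rw [he, Real.exp_log (hlc.pos x hx y), mul_comm] at h
  exact h

/-- The score has mean zero. -/
lemma IsValid.integral_score (hf : IsValid A ν f) (hlc : IsStrictlyLogConcave A f)
    {M c₂ c₃ y : ℝ} (hc₂ : ∀ x ∈ A, ∀ z ∈ Set.Icc (-M) M, |score f x z| ≤ c₂)
    (hc₃ : ∀ x ∈ A, ∀ z ∈ Set.Icc (-(M + 1)) (M + 1), |scoreDeriv f x z| ≤ c₃)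
    (hy : y ∈ Set.Icc (-M) M) : ∫ x in A, f x y * score f x y ∂ν = 0 := by
  have hball : ∀ z ∈ Metric.ball y 1, z ∈ Set.Icc (-(M + 1)) (M + 1) := by
    intro z hz
    rw [Metric.mem_ball, Real.dist_eq] at hz
    have := abs_lt.1 hz
    exact ⟨by linarith [hy.1], by linarith [hy.2]⟩
  have hyy : y ∈ Metric.ball y 1 := Metric.mem_ball_self one_pos
  -- The bound c₂ is used only at y; the mean value theorem with c₃ extends it to the unit ball. A
  -- second use, for log f, dominates f(x; z) by a multiple of f(x; y), which justifies
  -- differentiating ∫ f = 1 under the integral.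
  have hscore : ∀ x ∈ A, ∀ z ∈ Metric.ball y 1, |score f x z| ≤ c₂ + c₃ := by
    intro x hx z hz
    have h1 := (convex_ball y 1).norm_image_sub_le_of_norm_deriv_le
      (f := score f x) (C := c₃) (fun w _ => hlc.differentiable_score x hx w)
      (fun w hw => hc₃ x hx w (hball w hw)) hyy hz
    rw [Real.norm_eq_abs, Real.norm_eq_abs] at h1
    have hc0 : 0 ≤ c₃ := (abs_nonneg _).trans (hc₃ x hx y (hball y hyy))
    rw [Metric.mem_ball, Real.dist_eq] at hz
    have h2 : c₃ * |z - y| ≤ c₃ := by nlinarith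
    have h3 := hc₂ x hx y hy
    have h4 := abs_add_le (score f x y) (score f x z - score f x y)
    rw [add_sub_cancel] at h4
    linarith
  have hfle : ∀ x ∈ A, ∀ z ∈ Metric.ball y 1, f x z ≤ f x y * Real.exp (c₂ + c₃) := by
    intro x hx z hz
    have h1 := (convex_ball y 1).norm_image_sub_le_of_norm_deriv_le
      (f := fun w => Real.log (f x w)) (C := c₂ + c₃)
      (fun w _ => hlc.differentiable_log x hx w) (fun w hw => hscore x hx w hw) hyy hz
    rw [Real.norm_eq_abs, Real.norm_eq_abs] at h1
    have hc0 : 0 ≤ c₂ + c₃ := (abs_nonneg _).trans (hscore x hx y hyy)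
    rw [Metric.mem_ball, Real.dist_eq] at hz
    have h2 : (c₂ + c₃) * |z - y| ≤ c₂ + c₃ := by nlinarith
    have h3 := (le_abs_self _).trans (h1.trans h2)
    calc f x z = Real.exp (Real.log (f x z)) := (Real.exp_log (hlc.pos x hx z)).symm
      _ ≤ Real.exp (Real.log (f x y) + (c₂ + c₃)) := Real.exp_le_exp.2 (by linarith)
      _ = f x y * Real.exp (c₂ + c₃) := by rw [Real.exp_add, Real.exp_log (hlc.pos x hx y)]
  have hder := (hasDerivAt_integral_of_dominated_loc_of_deriv_le (μ := ν.restrict A)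
    (F := fun z x => f x z) (F' := fun z x => score f x z * f x z) (x₀ := y)
    (s := Metric.ball y 1) (bound := fun x => (c₂ + c₃) * (f x y * Real.exp (c₂ + c₃)))
    (Metric.ball_mem_nhds y one_pos)
    (Eventually.of_forall fun z => (hf.aemeasurable z).aestronglyMeasurable) (hf.integrable y)
    ((hf.aemeasurable_score hlc y).mul (hf.aemeasurable y)).aestronglyMeasurable
    (by
      filter_upwards [hf.ae_mem] with x hx z hz
      rw [norm_mul, Real.norm_eq_abs, Real.norm_eq_abs, abs_of_pos (hlc.pos x hx z)]
      exact mul_le_mul (hscore x hx z hz) (hfle x hx z hz) (hlc.pos x hx z).le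
        ((abs_nonneg _).trans (hscore x hx z hz)))
    (((hf.integrable y).mul_const _).const_mul _)
    (by
      filter_upwards [hf.ae_mem] with x hx z _
      exact hlc.hasDerivAt hx z)).2
  have hconst : (fun z => ∫ x in A, f x z ∂ν) = fun _ => 1 := funext hf.integral_eq_one
  rw [hconst] at hder
  have := hder.unique (hasDerivAt_const y (1 : ℝ))
  simpa only [mul_comm] using this

lemma IsValid.measure_inter_Ioi [ν.IsNegInvariant] (hf : IsValid A ν f) :
    ν (A ∩ Set.Ioi 0) = ν (A ∩ Set.Iio 0) := by
  rw [← Measure.measure_preimage_neg ν (A ∩ Set.Iio 0)]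
  congr 1
  ext x
  simp only [Set.mem_inter_iff, Set.mem_Ioi, Set.mem_preimage, Set.mem_Iio, Left.neg_neg_iff]
  exact ⟨fun h => ⟨hf.symm x h.1, h.2⟩, fun h => ⟨neg_neg x ▸ hf.symm _ h.1, h.2⟩⟩

/-- Strict log-concavity forces a positive mass of losing outcomes. -/
lemma IsValid.measure_neg_ne_zero [ν.IsNegInvariant] (hf : IsValid A ν f)
    (hlc : IsStrictlyLogConcave A f) : ν (A ∩ Set.Iio 0) ≠ 0 := by
  intro h0
  have h1 : ν (A ∩ Set.Ioi 0) = 0 := by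
    rw [hf.measure_inter_Ioi, h0]
  have hdiff : ν (A \ {0}) = 0 := by
    refine measure_mono_null (t := (A ∩ Set.Iio 0) ∪ (A ∩ Set.Ioi 0)) (fun x hx => ?_)
      (measure_union_null h0 h1)
    rcases lt_or_gt_of_ne (fun h => hx.2 h : x ≠ 0) with h | h
    · exact Or.inl ⟨hx.1, h⟩
    · exact Or.inr ⟨hx.1, h⟩
  -- All mass now sits at the outcome 0, so f(0; ·) is constant, against the strict negativity of
  -- g₂.
  have hone : ∀ y, ∫⁻ x in A ∩ {0}, ENNReal.ofReal (f x y) ∂ν = 1 := by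
    intro y
    rw [← hf.lintegral_eq_one y]
    refine setLIntegral_congr ?_
    refine (ae_eq_set.2 ⟨?_, ?_⟩)
    · rw [Set.sdiff_eq_empty.2 Set.inter_subset_left, measure_empty]
    · rwa [Set.sdiff_self_inter]
  by_cases hA : (0 : ℝ) ∈ A
  · rw [Set.inter_eq_self_of_subset_right (Set.singleton_subset_iff.2 hA)] at hone
    have hval : ∀ y, f 0 y = (ν {0})⁻¹.toReal := by
      intro y
      have h := hone y
      rw [lintegral_singleton] at h
      rw [← ENNReal.eq_inv_of_mul_eq_one_left h, ENNReal.toReal_ofReal (hf.nonneg 0 hA y)]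
    have hs : score f 0 = fun _ => 0 := by
      funext y
      simp only [score, hval, deriv_const]
    have := hlc.scoreDeriv_neg 0 hA 0
    rw [scoreDeriv, hs, deriv_const] at this
    exact lt_irrefl _ this
  · have := hone 0
    rw [Set.inter_singleton_eq_empty.2 hA] at this
    simp at this

lemma IsValid.setIntegral_pos (hf : IsValid A ν f) (hlc : IsStrictlyLogConcave A f)
    {B : Set ℝ} (h0 : ν (A ∩ B) ≠ 0) (y : ℝ) :
    0 < ∫ x in A ∩ B, f x y ∂ν := by
  have hle : ν.restrict (A ∩ B) ≤ ν.restrict A := Measure.restrict_mono Set.inter_subset_left le_rfl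
  rw [setIntegral_pos_iff_support_of_nonneg_ae (ae_mono hle (hf.ae_nonneg y))
    ((hf.integrable y).mono_measure hle)]
  rw [Set.inter_eq_self_of_subset_right]
  · exact pos_iff_ne_zero.2 h0
  · exact fun x hx => (hlc.pos x hx.1 y).ne'

/-- By symmetry f(x; ·) is nondecreasing for x > 0, so the winning mass at M is at least that at 0.
The losing mass stays positive at every M, whence C⁽¹⁾ < 1. -/
lemma IsValid.exists_C₁_bounds [ν.IsNegInvariant] (hf : IsValid A ν f)
    (hlc : IsStrictlyLogConcave A f) :
    ∃ c > 0, ∀ M, 0 ≤ M → c ≤ C₁ A ν f M ∧ C₁ A ν f M < 1 := by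
  have hneg := hf.measure_neg_ne_zero hlc
  have hpos : ν (A ∩ Set.Ioi 0) ≠ 0 := hf.measure_inter_Ioi ▸ hneg
  refine ⟨∫ x in A ∩ Set.Ioi 0, f x 0 ∂ν, hf.setIntegral_pos hlc hpos 0,
    fun M hM => ⟨?_, ?_⟩⟩
  · have hint : ∀ y (B : Set ℝ), IntegrableOn (fun x => f x y) (A ∩ B) ν := fun y B =>
      (show IntegrableOn (fun x => f x y) A ν from hf.integrable y).mono_set Set.inter_subset_left
    calc ∫ x in A ∩ Set.Ioi 0, f x 0 ∂ν ≤ ∫ x in A ∩ Set.Ioi 0, f x M ∂ν := by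
          refine setIntegral_mono_on (hint 0 _) (hint M _)
            (hf.measurableSet.inter measurableSet_Ioi) fun x hx => ?_
          have hx0 : -x < 0 := neg_lt_zero.2 hx.2
          rw [hf.even x hx.1 0, hf.even x hx.1 M]
          exact hf.antitone (-x) (hf.symm x hx.1) hx0 (by linarith)
      _ ≤ C₁ A ν f M := by
          refine setIntegral_mono_set (hint M _) ?_ ?_
          · filter_upwards [ae_restrict_mem (hf.measurableSet.inter measurableSet_Ici)] with x hx
            exact hf.nonneg x hx.1 M
          · exact (Set.inter_subset_inter_right A Set.Ioi_subset_Ici_self).eventuallyLE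
  · have h1 := hf.integral_eq_one M
    have h2 := hf.setIntegral_pos hlc hneg M
    have h3 := integral_inter_add_sdiff (s := A) (t := Set.Ici (0 : ℝ)) (f := fun x => f x M)
      measurableSet_Ici (hf.integrable M)
    have h4 : A \ Set.Ici (0 : ℝ) = A ∩ Set.Iio 0 := by ext x; simp
    rw [h4, h1] at h3
    unfold C₁
    linarith

end Density

/-! ### From comparison data to the good event. -/

section Outcomes

variable {A : Set ℝ} {ν : Measure ℝ} {f : ℝ → ℝ → ℝ}

lemma outcomeLaw_absolutelyContinuous (A : Set ℝ) (ν : Measure ℝ) (f : ℝ → ℝ → ℝ) (y : ℝ) :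
    outcomeLaw A ν f y ≪ ν.restrict A :=
  withDensity_absolutelyContinuous _ _

lemma IsValid.integral_outcomeLaw (hf : IsValid A ν f) (y : ℝ) (h : ℝ → ℝ) :
    ∫ x, h x ∂(outcomeLaw A ν f y) = ∫ x in A, f x y * h x ∂ν := by
  unfold outcomeLaw
  rw [integral_withDensity_eq_integral_toReal_smul₀ (hf.aemeasurable y).ennreal_ofReal
    (ae_of_all _ fun _ => ENNReal.ofReal_lt_top)]
  refine integral_congr_ae ?_
  filter_upwards [hf.ae_nonneg y] with x hx
  rw [ENNReal.toReal_ofReal hx, smul_eq_mul]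

lemma le_dynamicRange {n : ℕ} (u : Fin n → ℝ) (i j : Fin n) : |u i - u j| ≤ dynamicRange u :=
  le_ciSup (f := fun e : Fin n × Fin n => |u e.1 - u e.2|) (Set.finite_range _).bddAbove (i, j)

lemma dynamicRange_nonneg {n : ℕ} (u : Fin n → ℝ) : 0 ≤ dynamicRange u :=
  Real.iSup_nonneg fun _ => abs_nonneg _

variable {n T : ℕ} {p : unitInterval} {u : Fin n → ℝ} {Ω : Type*} [MeasurableSpace Ω]
  {P : Measure Ω} {N : Pair n → Ω → ℕ} {X : Pair n → Fin T → Ω → ℝ}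

lemma IsComparisonData.ae_mem (hdata : IsComparisonData A ν f T p u P N X) (hf : IsValid A ν f)
    (e : Pair n) (t : Fin T) : ∀ᵐ ω ∂P, X e t ω ∈ A := by
  have h := (outcomeLaw_absolutelyContinuous A ν f (u e.1.1 - u e.1.2)).ae_le hf.ae_mem
  rw [← (hdata.hasLaw_outcome e t).map_eq] at h
  exact ae_of_ae_map (hdata.hasLaw_outcome e t).aemeasurable h

/-- The score of an outcome at the true relative score. -/
noncomputable def trueScore (f : ℝ → ℝ → ℝ) (u : Fin n → ℝ) (X : Pair n → Fin T → Ω → ℝ)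
    (q : Pair n × Fin T) (ω : Ω) : ℝ :=
  score f (X q.1 q.2 ω) (u q.1.1.1 - u q.1.1.2)

lemma IsComparisonData.aemeasurable_score_map (hdata : IsComparisonData A ν f T p u P N X)
    (hf : IsValid A ν f) (hlc : IsStrictlyLogConcave A f) (q : Pair n × Fin T) :
    AEMeasurable (fun x => score f x (u q.1.1.1 - u q.1.1.2)) (P.map (X q.1 q.2)) := by
  rw [(hdata.hasLaw_outcome q.1 q.2).map_eq]
  exact (hf.aemeasurable_score hlc _).mono_ac (outcomeLaw_absolutelyContinuous _ _ _ _)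

lemma IsComparisonData.aemeasurable_trueScore (hdata : IsComparisonData A ν f T p u P N X)
    (hf : IsValid A ν f) (hlc : IsStrictlyLogConcave A f) (q : Pair n × Fin T) :
    AEMeasurable (trueScore f u X q) P :=
  (hdata.aemeasurable_score_map hf hlc q).comp_aemeasurable
    (hdata.hasLaw_outcome q.1 q.2).aemeasurable

lemma IsComparisonData.iIndepFun_trueScore (hdata : IsComparisonData A ν f T p u P N X)
    (hf : IsValid A ν f) (hlc : IsStrictlyLogConcave A f) :
    iIndepFun (trueScore f u X) P :=
  hdata.indep_outcome.comp₀ (fun q x => score f x (u q.1.1.1 - u q.1.1.2))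
    (fun q => (hdata.hasLaw_outcome q.1 q.2).aemeasurable)
    (hdata.aemeasurable_score_map hf hlc)

lemma IsComparisonData.indepFun_trueScore (hdata : IsComparisonData A ν f T p u P N X)
    (hf : IsValid A ν f) (hlc : IsStrictlyLogConcave A f) :
    IndepFun (fun ω e => N e ω) (fun ω q => trueScore f u X q ω) P := by
  have hXm : AEMeasurable (fun ω (s : Pair n × Fin T) => X s.1 s.2 ω) P :=
    aemeasurable_pi_lambda _ fun q => (hdata.hasLaw_outcome q.1 q.2).aemeasurable
  refine hdata.indep_mult_outcome.comp₀ (φ := id)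
    (ψ := fun (y : Pair n × Fin T → ℝ) q => score f (y q) (u q.1.1.1 - u q.1.1.2))
    (aemeasurable_pi_lambda _ fun e => (hdata.hasLaw_mult e).aemeasurable) hXm aemeasurable_id
    (aemeasurable_pi_lambda _ fun q => ?_)
  refine AEMeasurable.comp_aemeasurable (g := fun x => score f x (u q.1.1.1 - u q.1.1.2))
    (f := fun y : Pair n × Fin T → ℝ => y q) ?_ (measurable_pi_apply q).aemeasurable
  rw [AEMeasurable.map_map_of_aemeasurable (measurable_pi_apply q).aemeasurable hXm]
  exact hdata.aemeasurable_score_map hf hlc q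

lemma IsComparisonData.integral_trueScore (hdata : IsComparisonData A ν f T p u P N X)
    (hf : IsValid A ν f) (hlc : IsStrictlyLogConcave A f) {M c₂ c₃ : ℝ}
    (hM : ∀ i j, |u i - u j| ≤ M) (hc₂ : ∀ x ∈ A, ∀ z ∈ Set.Icc (-M) M, |score f x z| ≤ c₂)
    (hc₃ : ∀ x ∈ A, ∀ z ∈ Set.Icc (-(M + 1)) (M + 1), |scoreDeriv f x z| ≤ c₃)
    (q : Pair n × Fin T) : ∫ ω, trueScore f u X q ω ∂P = 0 := by
  unfold trueScore
  rw [← integral_map (f := fun x => score f x (u q.1.1.1 - u q.1.1.2))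
    (hdata.hasLaw_outcome q.1 q.2).aemeasurable
    (hdata.aemeasurable_score_map hf hlc q).aestronglyMeasurable,
    (hdata.hasLaw_outcome q.1 q.2).map_eq, hf.integral_outcomeLaw]
  exact hf.integral_score hlc hc₂ hc₃ (abs_le.1 (hM _ _))

/-- The nonasymptotic form of the theorem. -/
theorem IsComparisonData.exists_event [IsProbabilityMeasure P]
    (hdata : IsComparisonData A ν f T p u P N X)
    (hf : IsValid A ν f) (hlc : IsStrictlyLogConcave A f) (hT : 1 ≤ T) (hn : 2 ≤ n)
    (hu : u ∈ normalized n) {M c₂ c₃ c₄ δ : ℝ} {K : ℕ}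
    (hM : ∀ i j, |u i - u j| ≤ M) (hc₂0 : 0 < c₂)
    (hc₂ : ∀ x ∈ A, ∀ z ∈ Set.Icc (-M) M, |score f x z| ≤ c₂)
    (hc₃ : ∀ x ∈ A, ∀ z ∈ Set.Icc (-(M + 1)) (M + 1), |scoreDeriv f x z| ≤ c₃) (hc₄0 : 0 < c₄)
    (hc₄ : ∀ x ∈ A, ∀ y ∈ Set.Icc (-(M + 1)) (M + 1), ∀ y' ∈ Set.Icc (-(M + 1)) (M + 1), y ≤ y' →
      c₄ * (y' - y) ≤ score f x y - score f x y')
    (hx : 320 * Real.log n ≤ n * (p : ℝ))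
    (hK : (n : ℝ) ≤ (n * (p : ℝ) / (320 * Real.log n)) ^ K)
    (hδ : δ = 16 * (T + 3) * (c₂ / c₄) * √(Real.log n / (n * (p : ℝ))))
    (hr : 2 * ((K + 64 * T : ℕ) * δ) < 1) :
    ∃ E : Set Ω, MeasurableSet E ∧ 1 - 14 / (n : ℝ) ^ 2 ≤ P.real E ∧ ∀ ω ∈ E,
      ∃ v, IsMLE f (fun e => N e ω) (fun e t => X e t ω) v ∧
        (∀ v', IsMLE f (fun e => N e ω) (fun e t => X e t ω) v' → v' = v) ∧
        ‖v - u‖ ≤ 2 * ((K + 64 * T : ℕ) * δ) := by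
  have hn2 : (2 : ℝ) ≤ n := by exact_mod_cast hn
  have hL : 0 < Real.log n := Real.log_pos (by linarith)
  have hx0 : 0 < (n : ℝ) * (p : ℝ) := lt_of_lt_of_le (by positivity) hx
  have hbound : ∀ q, ∀ᵐ ω ∂P, trueScore f u X q ω ∈ Set.Icc (-c₂) c₂ := by
    intro q
    filter_upwards [hdata.ae_mem hf q.1 q.2] with ω hω
    exact abs_le.1 (hc₂ _ hω _ (abs_le.1 (hM _ _)))
  have h1 := measure_sparse_cut_le hdata.hasLaw_mult hdata.indep_mult hT (by omega)
    (by linarith)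
  have h2 := measure_dense_pair_le hdata.hasLaw_mult hdata.indep_mult hT hn hx
  have h3 := measure_large_noise_le hdata.hasLaw_mult hdata.indep_mult
    (hdata.aemeasurable_trueScore hf hlc) hc₂0 hbound
    (hdata.integral_trueScore hf hlc hM hc₂ hc₃) (hdata.iIndepFun_trueScore hf hlc)
    (hdata.indepFun_trueScore hf hlc) hn (by linarith)
  have h0 : P.real {ω | ¬((∀ e, N e ω ≤ T) ∧ ∀ e t, X e t ω ∈ A)} = 0 := by
    rw [measureReal_eq_zero_iff]
    have hN : ∀ᵐ ω ∂P, ∀ e, N e ω ≤ T :=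
      ae_all_iff.2 fun e => ae_le_of_hasLaw_binomial (hdata.hasLaw_mult e)
    have hX : ∀ᵐ ω ∂P, ∀ e t, X e t ω ∈ A :=
      ae_all_iff.2 fun e => ae_all_iff.2 fun t => hdata.ae_mem hf e t
    exact ae_iff.1 (hN.and hX)
  set B₀ := {ω | ¬((∀ e, N e ω ≤ T) ∧ ∀ e t, X e t ω ∈ A)} with hB₀
  set B₁ := {ω | ∃ S ∈ Finset.univ.filter fun S : Finset (Fin n) => S.Nonempty,
      2 * S.card ≤ n ∧ ∑ e ∈ crossing S Sᶜ, (N e ω : ℝ) ≤ S.card * (n * (p : ℝ)) / 8} with hB₁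
  set B₂ := {ω | ∃ z ∈ (Finset.univ.filter fun S : Finset (Fin n) => S.Nonempty) ×ˢ
        (Finset.univ : Finset (Finset (Fin n))),
      (Disjoint z.1 z.2 ∧ (z.2.card : ℝ) ≤ n / (64 * T : ℕ) ∧
        (z.2.card : ℝ) ≤ n * (p : ℝ) / (320 * Real.log n) * z.1.card) ∧
      z.1.card * (n * (p : ℝ)) / 16 ≤ ∑ e ∈ crossing z.1 z.2, (N e ω : ℝ)} with hB₂
  set B₃ := {ω | ∃ S ∈ Finset.univ.filter fun S : Finset (Fin n) => S.Nonempty,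
      (T + 3) * c₂ * √(Real.log n * (n * (p : ℝ))) * S.card <
        |observedSum (crossing S Sᶜ) (orient S) (fun e => N e ω)
          fun q => trueScore f u X q ω|} with hB₃
  have hbad : P.real (B₀ ∪ (B₁ ∪ (B₂ ∪ B₃))) ≤ 14 / (n : ℝ) ^ 2 := by
    have e1 := measureReal_union_le (μ := P) B₀ (B₁ ∪ (B₂ ∪ B₃))
    have e2 := measureReal_union_le (μ := P) B₁ (B₂ ∪ B₃)
    have e3 := measureReal_union_le (μ := P) B₂ B₃
    -- The three events cost 2 + 3 + 4 = 9, within the stated 14.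
    have e4 : 2 / (n : ℝ) ^ 2 + (3 / (n : ℝ) ^ 2 + 4 / (n : ℝ) ^ 2) ≤ 14 / (n : ℝ) ^ 2 := by
      rw [← add_div, ← add_div]
      gcongr
      norm_num
    linarith
  -- The bad set need not be measurable, since scores and data are only almost everywhere
  -- measurable; its measurable hull has the same probability.
  refine ⟨(toMeasurable P (B₀ ∪ (B₁ ∪ (B₂ ∪ B₃))))ᶜ, (measurableSet_toMeasurable _ _).compl,
    ?_, fun ω hω => ?_⟩
  · rw [probReal_compl_eq_one_sub (measurableSet_toMeasurable _ _), measureReal_def,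
      measure_toMeasurable, ← measureReal_def]
    linarith
  · have hω' : ω ∉ B₀ ∪ (B₁ ∪ (B₂ ∪ B₃)) := fun h => hω (subset_toMeasurable _ _ h)
    simp only [Set.mem_union, not_or] at hω'
    obtain ⟨g0, g1, g2, g3⟩ := hω'
    rw [hB₀, Set.mem_ofPred_eq, not_not] at g0
    obtain ⟨hNT, hXA⟩ := g0
    simp only [hB₁, Set.mem_ofPred_eq, Finset.mem_filter, Finset.mem_univ, true_and, not_exists,
      not_and, not_le] at g1
    simp only [hB₂, Set.mem_ofPred_eq, Finset.mem_product, Finset.mem_filter, Finset.mem_univ,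
      true_and, and_true, not_exists, not_and, not_le, Prod.forall] at g2
    simp only [hB₃, Set.mem_ofPred_eq, Finset.mem_filter, Finset.mem_univ, true_and, not_exists,
      not_and, not_lt] at g3
    have hobs : ∀ s : Finset (Pair n), ∑ e ∈ s, observed T (fun e => N e ω) e =
        ∑ e ∈ s, (N e ω : ℝ) := fun s => Finset.sum_congr rfl fun e _ => observed_eq (hNT e)
    have hδ0 : 0 < δ := by rw [hδ]; positivity
    refine exists_unique_isMLE_of_expansion (x := n * (p : ℝ))
      (ρ := n * (p : ℝ) / (320 * Real.log n)) hlc hXA hu (by omega) hM hc₄0 hc₄ hx0.le hδ0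
      ((one_le_div (by positivity)).2 hx) (by omega) hK (fun S hS h => ?_)
      (fun S R hS hSR hR1 hR2 => ?_) (fun S hS => ?_) hr
    · rw [hobs]; exact g1 S hS h
    · rw [hobs]; exact g2 S R hS ⟨hSR, hR1, hR2⟩
    · have h := g3 S hS
      rw [observedSum_eq] at h
      refine h.trans_eq ?_
      -- The value of δ is the one with c₄ δ x/16 = (T+3) c₂ √(x log n), where x = np.
      have hs : √(Real.log n / (n * (p : ℝ))) * (n * (p : ℝ)) =
          √(Real.log n * (n * (p : ℝ))) := by
        rw [← Real.sqrt_sq hx0.le, ← Real.sqrt_mul (by positivity), Real.sqrt_sq hx0.le]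
        congr 1
        field_simp
      rw [hδ, ← hs]
      field_simp

end Outcomes

/-! ### Finiteness and comparison of the constants. -/

section Constants

variable {A : Set ℝ} {ν : Measure ℝ} {f : ℝ → ℝ → ℝ}

lemma IsStrictlyLogConcave.score_strictAnti (hlc : IsStrictlyLogConcave A f) {x : ℝ}
    (hx : x ∈ A) : StrictAnti (score f x) :=
  strictAnti_of_deriv_neg fun y => hlc.scoreDeriv_neg x hx y

lemma IsValid.score_nonpos (hf : IsValid A ν f) (hlc : IsStrictlyLogConcave A f) {x : ℝ}
    (hx : x ∈ A) (hx0 : x < 0) (y : ℝ) : score f x y ≤ 0 := by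
  have : Antitone fun z => Real.log (f x z) := fun a b hab =>
    Real.log_le_log (hlc.pos x hx b) (hf.antitone x hx hx0 hab)
  exact this.deriv_nonpos

lemma IsStrictlyLogConcave.mul_sub_le_score_sub (hlc : IsStrictlyLogConcave A f) {M c : ℝ}
    (hc : ∀ x ∈ A, ∀ z ∈ Set.Icc (-(M + 1)) (M + 1), c ≤ |scoreDeriv f x z|) {x : ℝ}
    (hx : x ∈ A) {y : ℝ} (hy : y ∈ Set.Icc (-(M + 1)) (M + 1)) {y' : ℝ}
    (hy' : y' ∈ Set.Icc (-(M + 1)) (M + 1)) (h : y ≤ y') :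
    c * (y' - y) ≤ score f x y - score f x y' := by
  have := (convex_Icc (-(M + 1)) (M + 1)).image_sub_le_mul_sub_of_deriv_le (C := -c)
    (hlc.differentiable_score x hx).continuous.continuousOn
    (hlc.differentiable_score x hx).differentiableOn (fun z hz => by
      have h1 := hc x hx z (interior_subset hz)
      rw [abs_of_neg (hlc.scoreDeriv_neg x hx z)] at h1
      change scoreDeriv f x z ≤ -c
      linarith) y hy y' hy' h
  linarith

/-- If the rate is finite, the constants are finite and positive. -/
lemma exists_constants [ν.IsNegInvariant] (hf : IsValid A ν f) (hlc : IsStrictlyLogConcave A f)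
    {M a : ℝ} (hM : 0 ≤ M) (ha : 0 < a)
    (h : C₂ A f M * C₃ A f M / C₄ A f M ^ 2 * ENNReal.ofReal a ≠ ⊤) :
    ∃ c₂ c₃ c₄ : ℝ, 0 < c₄ ∧ c₄ ≤ c₂ ∧ c₄ ≤ c₃ ∧
      C₂ A f M * C₃ A f M / C₄ A f M ^ 2 * ENNReal.ofReal a =
        ENNReal.ofReal (c₂ * c₃ / c₄ ^ 2 * a) ∧
      (∀ x ∈ A, ∀ z ∈ Set.Icc (-M) M, |score f x z| ≤ c₂) ∧
      (∀ x ∈ A, ∀ z ∈ Set.Icc (-(M + 1)) (M + 1), |scoreDeriv f x z| ≤ c₃) ∧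
      (∀ x ∈ A, ∀ z ∈ Set.Icc (-(M + 1)) (M + 1), c₄ ≤ |scoreDeriv f x z|) := by
  obtain ⟨x₀, hx₀, hx₀neg⟩ := nonempty_of_measure_ne_zero (hf.measure_neg_ne_zero hlc)
  have h0M : (0 : ℝ) ∈ Set.Icc (-M) M := ⟨by linarith, hM⟩
  have h0M' : (0 : ℝ) ∈ Set.Icc (-(M + 1)) (M + 1) := ⟨by linarith, by linarith⟩
  have h1M' : (-1 : ℝ) ∈ Set.Icc (-(M + 1)) (M + 1) := ⟨by linarith, by linarith⟩
  have le2 : ∀ x ∈ A, ∀ z ∈ Set.Icc (-M) M, ENNReal.ofReal |score f x z| ≤ C₂ A f M :=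
    fun x hx z hz => le_iSup₂_of_le x hx (le_iSup₂_of_le z hz le_rfl)
  have le3 : ∀ x ∈ A, ∀ z ∈ Set.Icc (-(M + 1)) (M + 1),
      ENNReal.ofReal |scoreDeriv f x z| ≤ C₃ A f M :=
    fun x hx z hz => le_iSup₂_of_le x hx (le_iSup₂_of_le z hz le_rfl)
  have le4 : ∀ x ∈ A, ∀ z ∈ Set.Icc (-(M + 1)) (M + 1),
      C₄ A f M ≤ ENNReal.ofReal |scoreDeriv f x z| :=
    fun x hx z hz => iInf₂_le_of_le x hx (iInf₂_le_of_le z hz le_rfl)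
  have hlt : score f x₀ 0 < score f x₀ (-1) := hlc.score_strictAnti hx₀ (by norm_num)
  have hle : score f x₀ (-1) ≤ 0 := hf.score_nonpos hlc hx₀ hx₀neg _
  -- Nonvanishing of C⁽²⁾ and C⁽³⁾ is needed because 0 · ∞ and 0 / 0 are 0 in extended reals, which
  -- could hide an infinite or degenerate constant.
  have h2ne : C₂ A f M ≠ 0 := by
    refine (lt_of_lt_of_le ?_ (le2 x₀ hx₀ 0 h0M)).ne'
    exact ENNReal.ofReal_pos.2 (abs_pos.2 (by linarith))
  have h3ne : C₃ A f M ≠ 0 := by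
    refine (lt_of_lt_of_le ?_ (le3 x₀ hx₀ 0 h0M')).ne'
    exact ENNReal.ofReal_pos.2 (abs_pos.2 (hlc.scoreDeriv_neg x₀ hx₀ 0).ne)
  have hane : ENNReal.ofReal a ≠ 0 := (ENNReal.ofReal_pos.2 ha).ne'
  have h4top : C₄ A f M ≠ ⊤ := ((le4 x₀ hx₀ 0 h0M').trans_lt ENNReal.ofReal_lt_top).ne
  have hq : C₂ A f M * C₃ A f M / C₄ A f M ^ 2 ≠ ⊤ := fun hq => h (by
    rw [hq, ENNReal.top_mul hane])
  have h4ne : C₄ A f M ≠ 0 := fun h4 => hq (by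
    rw [h4, zero_pow two_ne_zero, ENNReal.div_zero (mul_ne_zero h2ne h3ne)])
  have h23 : C₂ A f M * C₃ A f M ≠ ⊤ := fun h23 => hq (by
    rw [h23, ENNReal.top_div_of_ne_top (ENNReal.pow_ne_top h4top)])
  have h2top : C₂ A f M ≠ ⊤ := fun h2 => h23 (by rw [h2, ENNReal.top_mul h3ne])
  have h3top : C₃ A f M ≠ ⊤ := fun h3 => h23 (by rw [h3, ENNReal.mul_top h2ne])
  have hb2 : ∀ x ∈ A, ∀ z ∈ Set.Icc (-M) M, |score f x z| ≤ (C₂ A f M).toReal :=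
    fun x hx z hz => (ENNReal.ofReal_le_iff_le_toReal h2top).1 (le2 x hx z hz)
  have hb3 : ∀ x ∈ A, ∀ z ∈ Set.Icc (-(M + 1)) (M + 1),
      |scoreDeriv f x z| ≤ (C₃ A f M).toReal :=
    fun x hx z hz => (ENNReal.ofReal_le_iff_le_toReal h3top).1 (le3 x hx z hz)
  have hb4 : ∀ x ∈ A, ∀ z ∈ Set.Icc (-(M + 1)) (M + 1),
      (C₄ A f M).toReal ≤ |scoreDeriv f x z| :=
    fun x hx z hz => (ENNReal.le_ofReal_iff_toReal_le h4top (abs_nonneg _)).1 (le4 x hx z hz)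
  have hpos4 : 0 < (C₄ A f M).toReal := ENNReal.toReal_pos h4ne h4top
  refine ⟨(C₂ A f M).toReal, (C₃ A f M).toReal, (C₄ A f M).toReal, hpos4, ?_,
    (hb4 x₀ hx₀ 0 h0M').trans (hb3 x₀ hx₀ 0 h0M'), ?_, hb2, hb3, hb4⟩
  -- For a losing outcome the score is nonpositive at -1 and drops by at least c₄ up to 0, so |g(x₀;
  -- 0)| ≥ c₄. The point -1 is allowed even if M = 0.
  · have h5 := hlc.mul_sub_le_score_sub hb4 hx₀ h1M' h0M' (by norm_num)
    have h6 := neg_le_of_abs_le (hb2 x₀ hx₀ 0 h0M)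
    linarith
  · rw [ENNReal.ofReal_mul (by positivity), ENNReal.ofReal_div_of_pos (by positivity),
      ENNReal.ofReal_mul ENNReal.toReal_nonneg, ENNReal.ofReal_pow ENNReal.toReal_nonneg,
      ENNReal.ofReal_toReal h2top, ENNReal.ofReal_toReal h3top, ENNReal.ofReal_toReal h4top]

end Constants

/-! ### Number of steps and the asymptotic rate. -/

section Rate

/-- Take K = ⌈3 log n / log x⌉. Squaring `hone` gives (log n)³ ≤ x (log x)², which with `hlog`
yields x ≤ ρ³; so log ρ ≥ (log x)/3 and ρ ^ K ≥ n. As x ≤ n, the ceiling costs at most one more log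
n / log x, which is the 4 in the constant. -/
lemma exists_steps {n T : ℕ} {x κ δ D : ℝ} (hn : 2 ≤ n) (hT : 1 ≤ T) (hxn : x ≤ n) (hx1 : 1 < x)
    (hx : 320 * Real.log n ≤ x) (hlog : 320 ^ 3 * Real.log x ^ 2 ≤ x) (hκ0 : 0 ≤ κ)
    (hδ : δ = 16 * (T + 3) * κ * √(Real.log n / x))
    (hD : κ * (√(Real.log n / x) * (Real.log n / Real.log x)) ≤ D)
    (hone : √(Real.log n / x) * (Real.log n / Real.log x) ≤ 1) :
    ∃ K : ℕ, (n : ℝ) ≤ (x / (320 * Real.log n)) ^ K ∧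
      2 * ((K + 64 * T : ℕ) * δ) ≤ 32 * (T + 3) * (4 + 64 * T) * D := by
  have hn2 : (2 : ℝ) ≤ n := by exact_mod_cast hn
  have hT1 : (1 : ℝ) ≤ T := by exact_mod_cast hT
  have hL : 0 < Real.log n := Real.log_pos (by linarith)
  set L := Real.log n with hLdef
  have hl : 0 < Real.log x := Real.log_pos hx1
  set l := Real.log x with hldef
  have hx0 : 0 < x := by linarith
  set ρ := x / (320 * L) with hρ
  have hρ0 : 0 < ρ := by positivity
  have hLl : 1 ≤ L / l := (one_le_div hl).2 (Real.log_le_log hx0 hxn)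
  have hcube : L ^ 3 ≤ x * l ^ 2 := by
    have h1 : (√(L / x) * (L / l)) ^ 2 ≤ 1 := pow_le_one₀ (by positivity) hone
    rw [mul_pow, Real.sq_sqrt (by positivity), div_pow, div_mul_div_comm,
      div_le_one (by positivity)] at h1
    calc L ^ 3 = L * L ^ 2 := by ring
      _ ≤ x * l ^ 2 := h1
  have hρ3 : x ≤ ρ ^ 3 := by
    rw [hρ, div_pow, le_div_iff₀ (by positivity)]
    calc x * (320 * L) ^ 3 = x * (320 ^ 3 * L ^ 3) := by ring
      _ ≤ x * (320 ^ 3 * (x * l ^ 2)) := by gcongr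
      _ = x * x * (320 ^ 3 * l ^ 2) := by ring
      _ ≤ x * x * x := by gcongr
      _ = x ^ 3 := by ring
  have hlogρ : l ≤ 3 * Real.log ρ := by
    have := Real.log_le_log hx0 hρ3
    rwa [Real.log_pow] at this
  refine ⟨⌈3 * (L / l)⌉₊, ?_, ?_⟩
  · have h1 : 3 * (L / l) ≤ (⌈3 * (L / l)⌉₊ : ℝ) := Nat.le_ceil _
    have h2 : L ≤ (⌈3 * (L / l)⌉₊ : ℝ) * Real.log ρ := by
      calc L = 3 * (L / l) * (l / 3) := by field_simp
        _ ≤ (⌈3 * (L / l)⌉₊ : ℝ) * Real.log ρ := by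
          refine mul_le_mul h1 (by linarith) (by positivity) (by positivity)
    rw [← Real.log_le_log_iff (by linarith) (by positivity), Real.log_pow]
    exact h2
  · have h1 : (⌈3 * (L / l)⌉₊ : ℝ) < 3 * (L / l) + 1 := Nat.ceil_lt_add_one (by positivity)
    have h2 : ((⌈3 * (L / l)⌉₊ + 64 * T : ℕ) : ℝ) ≤ (4 + 64 * T) * (L / l) := by
      push_cast
      nlinarith
    have hδ0 : 0 ≤ δ := by rw [hδ]; positivity
    calc 2 * (((⌈3 * (L / l)⌉₊ + 64 * T : ℕ) : ℝ) * δ)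
        ≤ 2 * ((4 + 64 * T) * (L / l) * δ) := by gcongr
      _ = 32 * (T + 3) * (4 + 64 * T) * (κ * (√(L / x) * (L / l))) := by rw [hδ]; ring
      _ ≤ 32 * (T + 3) * (4 + 64 * T) * D := by gcongr

/-- The first hypothesis of the theorem makes the expected degrees larger than `log n`. -/
lemma tendsto_log_div {A : Set ℝ} {ν : Measure ℝ} [ν.IsNegInvariant] {f : ℝ → ℝ → ℝ}
    (hf : IsValid A ν f) (hlc : IsStrictlyLogConcave A f) {p M : ℕ → ℝ} (hp : ∀ n, 0 < p n)
    (hM : ∀ n, 0 ≤ M n)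
    (h : Tendsto (fun n : ℕ => Real.log n / (n * p n * |Real.log (C₁ A ν f (M n))|))
      atTop (𝓝 0)) :
    Tendsto (fun n : ℕ => Real.log n / (n * p n)) atTop (𝓝 0) := by
  obtain ⟨c, hc0, hc⟩ := hf.exists_C₁_bounds hlc
  have h2 := h.const_mul (-Real.log c)
  rw [mul_zero] at h2
  refine squeeze_zero (fun n => div_nonneg (Real.log_natCast_nonneg n)
    (mul_nonneg (Nat.cast_nonneg n) (hp n).le)) (fun n => ?_) h2
  obtain ⟨h3, h4⟩ := hc (M n) (hM n)
  have hC0 := hc0.trans_le h3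
  -- Strictness matters: at C⁽¹⁾ = 1 the quotient in `h` would be 0 by convention and carry no
  -- information.
  have hneg : Real.log (C₁ A ν f (M n)) < 0 := Real.log_neg hC0 h4
  have hle := Real.log_le_log hc0 h3
  rw [abs_of_neg hneg]
  have hq : 0 ≤ Real.log n / (n * p n) := div_nonneg (Real.log_natCast_nonneg n)
    (mul_nonneg (Nat.cast_nonneg n) (hp n).le)
  rw [← div_div (Real.log n) (n * p n), mul_div_assoc', le_div_iff₀ (neg_pos.2 hneg), mul_comm]
  exact mul_le_mul_of_nonneg_right (by linarith) hq

end Rate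

/-! ### Almost sure conclusion. -/

section BorelCantelli

/-- Only the convergence half of Borel-Cantelli is used, so the dependence between different n is
irrelevant. -/
lemma ae_eventually_mem_of_le {Ω : Type*} [MeasurableSpace Ω] {P : Measure Ω}
    [IsProbabilityMeasure P] {E : ℕ → Set Ω} {c : ℝ}
    (h : ∀ᶠ n : ℕ in atTop, MeasurableSet (E n) ∧ 1 - c / (n : ℝ) ^ 2 ≤ P.real (E n)) :
    ∀ᵐ ω ∂P, ∀ᶠ n in atTop, ω ∈ E n := by
  classical
  obtain ⟨n₀, hn₀⟩ := eventually_atTop.1 h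
  have hsum : ∑' n, P (if n₀ ≤ n then (E n)ᶜ else ∅) ≠ ∞ := by
    have hs : Summable fun n : ℕ => c / (n : ℝ) ^ 2 := by
      simpa [div_eq_mul_inv] using (Real.summable_nat_pow_inv.2 one_lt_two).mul_left c
    refine ne_top_of_le_ne_top hs.tsum_ofReal_ne_top (ENNReal.tsum_le_tsum fun n => ?_)
    split_ifs with hn
    · obtain ⟨h1, h2⟩ := hn₀ n hn
      rw [← ENNReal.ofReal_toReal (measure_ne_top P (E n)ᶜ), ← measureReal_def,
        probReal_compl_eq_one_sub h1]
      exact ENNReal.ofReal_le_ofReal (by linarith)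
    · simp
  filter_upwards [ae_eventually_notMem hsum] with ω hω
  filter_upwards [hω, eventually_ge_atTop n₀] with n hn hn'
  rw [if_pos hn'] at hn
  exact not_not.1 hn

end BorelCantelli

end PairwiseComparison

/-! ### Assembly of the asymptotic theorem. -/

theorem mainTheorem1
    (A : Set ℝ) (ν : Measure ℝ) [ν.IsNegInvariant] (f : ℝ → ℝ → ℝ)
    (hf : PairwiseComparison.IsValid A ν f)
    (hlc : PairwiseComparison.IsStrictlyLogConcave A f)
    (T : ℕ) (hT : 1 ≤ T)
    (p : ℕ → unitInterval) (hp : ∀ n, 0 < (p n : ℝ))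
    (u : (n : ℕ) → Fin n → ℝ) (hu : ∀ n, u n ∈ PairwiseComparison.normalized n)
    {Ω : Type*} [MeasurableSpace Ω] (P : Measure Ω) [IsProbabilityMeasure P]
    (N : (n : ℕ) → PairwiseComparison.Pair n → Ω → ℕ)
    (X : (n : ℕ) → PairwiseComparison.Pair n → Fin T → Ω → ℝ)
    (hdata : ∀ n, PairwiseComparison.IsComparisonData A ν f T (p n) (u n) P (N n) (X n))
    (hexist : Tendsto (fun n : ℕ => Real.log n /
        (n * (p n : ℝ) *
          |Real.log (PairwiseComparison.C₁ A ν f (PairwiseComparison.dynamicRange (u n)))|))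
      atTop (𝓝 0))
    (hDelta : Tendsto (fun n : ℕ =>
        PairwiseComparison.Delta A f (PairwiseComparison.dynamicRange (u n)) n (p n))
      atTop (𝓝 0)) :
    (∃ C : ℝ≥0, ∀ᶠ n : ℕ in atTop, ∃ E : Set Ω, MeasurableSet E ∧
      1 - 14 / (n : ℝ) ^ 2 ≤ P.real E ∧
      ∀ ω ∈ E,
        (∃! v : Fin n → ℝ,
          PairwiseComparison.IsMLE f (fun e => N n e ω) (fun e t => X n e t ω) v) ∧
        ∀ v : Fin n → ℝ,
          PairwiseComparison.IsMLE f (fun e => N n e ω) (fun e t => X n e t ω) v →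
          ENNReal.ofReal ‖v - u n‖ ≤
            C * PairwiseComparison.Delta A f (PairwiseComparison.dynamicRange (u n)) n (p n)) ∧
    (∀ᵐ ω ∂P,
      (∀ᶠ n : ℕ in atTop, ∃! v : Fin n → ℝ,
        PairwiseComparison.IsMLE f (fun e => N n e ω) (fun e t => X n e t ω) v) ∧
      ∀ uhat : (n : ℕ) → Fin n → ℝ,
        (∀ᶠ n : ℕ in atTop,
          PairwiseComparison.IsMLE f (fun e => N n e ω) (fun e t => X n e t ω) (uhat n)) →
        Tendsto (fun n : ℕ => ‖uhat n - u n‖) atTop (𝓝 0)) := by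
  open PairwiseComparison in
  have hmain : ∃ C : ℝ≥0, ∀ᶠ n : ℕ in atTop, ∃ E : Set Ω, MeasurableSet E ∧
      1 - 14 / (n : ℝ) ^ 2 ≤ P.real E ∧
      ∀ ω ∈ E,
        (∃! v : Fin n → ℝ, IsMLE f (fun e => N n e ω) (fun e t => X n e t ω) v) ∧
        ∀ v : Fin n → ℝ, IsMLE f (fun e => N n e ω) (fun e t => X n e t ω) v →
          ENNReal.ofReal ‖v - u n‖ ≤ C * Delta A f (dynamicRange (u n)) n (p n) := by
    set B : ℝ := 32 * (T + 3) * (4 + 64 * T) with hB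
    have hB0 : 0 < B := by positivity
    have hB1 : 1 ≤ B := by
      have : (0 : ℝ) ≤ T := by positivity
      rw [hB]; nlinarith
    refine ⟨B.toNNReal, ?_⟩
    have hLx := tendsto_log_div hf hlc hp (fun n => dynamicRange_nonneg (u n)) hexist
    have hev1 := hLx.eventually_le_const (show (0 : ℝ) < 1 / 320 by norm_num)
    have hx1 : ∀ᶠ n : ℕ in atTop, 320 * Real.log n ≤ n * (p n : ℝ) := by
      filter_upwards [hev1, eventually_ge_atTop 1] with n hn hn1
      have : 0 < (n : ℝ) * (p n : ℝ) := mul_pos (by exact_mod_cast hn1) (hp n)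
      rw [div_le_div_iff₀ this (by norm_num)] at hn
      linarith
    have hxtop : Tendsto (fun n : ℕ => (n : ℝ) * (p n : ℝ)) atTop atTop := by
      refine tendsto_atTop_mono' _ hx1 ?_
      exact (Real.tendsto_log_atTop.comp tendsto_natCast_atTop_atTop).const_mul_atTop
        (by norm_num)
    have hlog : ∀ᶠ x : ℝ in atTop, 320 ^ 3 * Real.log x ^ 2 ≤ x := by
      have h := (Real.isLittleO_pow_log_id_atTop (n := 2)).bound
        (show (0 : ℝ) < 1 / 320 ^ 3 by positivity)
      filter_upwards [h, eventually_ge_atTop 0] with x hx hx0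
      simp only [id, Real.norm_eq_abs, abs_of_nonneg hx0, abs_pow, sq_abs] at hx
      linarith
    -- Below 1/B, the final error bound B Δ is less than 1, as interiority of the constrained
    -- maximizer requires.
    have hΔ := hDelta.eventually_lt_const
      (show (0 : ℝ≥0∞) < ENNReal.ofReal (1 / B) from ENNReal.ofReal_pos.2 (by positivity))
    filter_upwards [hx1, hxtop.eventually hlog, hxtop.eventually_gt_atTop 1, hΔ,
      eventually_ge_atTop 2] with n hx hlogx hxgt hΔn hn
    have hn2 : (2 : ℝ) ≤ n := by exact_mod_cast hn
    have hL : 0 < Real.log n := Real.log_pos (by linarith)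
    have hl : 0 < Real.log (n * (p n : ℝ)) := Real.log_pos hxgt
    set a := √(Real.log n / (n * (p n : ℝ))) * (Real.log n / Real.log (n * (p n : ℝ))) with ha
    have ha0 : 0 < a := by
      have : 0 < Real.log n / (n * (p n : ℝ)) := div_pos hL (by linarith)
      positivity
    obtain ⟨c₂, c₃, c₄, hc₄0, h42, h43, hΔeq, hb2, hb3, hb4⟩ :=
      exists_constants hf hlc (dynamicRange_nonneg (u n)) ha0 (hΔn.trans_le le_top).ne
    change Delta A f (dynamicRange (u n)) n (p n) = _ at hΔeq
    rw [hΔeq] at hΔn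
    have hD : c₂ * c₃ / c₄ ^ 2 * a < 1 / B := (ENNReal.ofReal_lt_ofReal_iff (by positivity)).1 hΔn
    -- The argument yields the factor c₂/c₄; the stated rate is weaker because c₄ ≤ c₃.
    have hκ : c₂ / c₄ ≤ c₂ * c₃ / c₄ ^ 2 := by
      rw [div_le_div_iff₀ hc₄0 (by positivity)]
      have : 0 < c₂ * c₄ := mul_pos (by linarith) hc₄0
      nlinarith
    have hκ1 : 1 ≤ c₂ / c₄ := (one_le_div hc₄0).2 h42
    have hDle : c₂ / c₄ * a ≤ c₂ * c₃ / c₄ ^ 2 * a := mul_le_mul_of_nonneg_right hκ ha0.le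
    -- Since c₄ ≤ c₂, the factor a is itself at most Δ < 1/B ≤ 1.
    have hone : a ≤ 1 := by
      have h1 : 1 / B ≤ 1 := by rw [div_le_one hB0]; exact hB1
      nlinarith
    obtain ⟨K, hK, hKδ⟩ := exists_steps (κ := c₂ / c₄) hn hT
      (mul_le_of_le_one_right (by positivity) (p n).2.2) hxgt hx hlogx (by linarith) rfl hDle hone
    have hBD : B * (c₂ * c₃ / c₄ ^ 2 * a) < 1 := by
      rw [lt_div_iff₀ hB0] at hD
      linarith
    obtain ⟨E, hE, hPE, hgood⟩ := (hdata n).exists_event hf hlc hT hn (hu n)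
      (le_dynamicRange (u n)) (by linarith) hb2 hb3 hc₄0
      (fun x hx y hy y' hy' h => hlc.mul_sub_le_score_sub hb4 hx hy hy' h) hx hK rfl
      (hKδ.trans_lt hBD)
    refine ⟨E, hE, hPE, fun ω hω => ?_⟩
    obtain ⟨v, hv, huniq, hnorm⟩ := hgood ω hω
    refine ⟨⟨v, hv, huniq⟩, fun v' hv' => ?_⟩
    rw [huniq v' hv', hΔeq]
    change _ ≤ ENNReal.ofReal B * _
    rw [← ENNReal.ofReal_mul hB0.le]
    exact ENNReal.ofReal_le_ofReal (hnorm.trans hKδ)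
  refine ⟨hmain, ?_⟩
  obtain ⟨C, hC⟩ := hmain
  obtain ⟨E, hE⟩ := hC.choice
  filter_upwards [ae_eventually_mem_of_le (hE.mono fun n hn => ⟨hn.1, hn.2.1⟩)] with ω hω
  refine ⟨?_, fun uhat huhat => ?_⟩
  · filter_upwards [hE, hω] with n hn hωn using (hn.2.2 ω hωn).1
  · have hlim : Tendsto (fun n : ℕ => (C : ℝ≥0∞) *
        PairwiseComparison.Delta A f (PairwiseComparison.dynamicRange (u n)) n (p n))
        atTop (𝓝 0) := by
      simpa using ENNReal.Tendsto.const_mul hDelta (Or.inr ENNReal.coe_ne_top)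
    have h2 : Tendsto (fun n : ℕ => ENNReal.ofReal ‖uhat n - u n‖) atTop (𝓝 0) := by
      refine tendsto_of_tendsto_of_tendsto_of_le_of_le' tendsto_const_nhds hlim
        (Eventually.of_forall fun _ => zero_le) ?_
      filter_upwards [hE, hω, huhat] with n hn hωn hun using (hn.2.2 ω hωn).2 _ hun
    have h3 := (ENNReal.tendsto_toReal ENNReal.zero_ne_top).comp h2
    simpa [Function.comp_def, ENNReal.toReal_ofReal] using h3
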